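/- **Setting.** Let $m=(m_0,m_1,\dots)$ be a bounded sequence of integers $m_k\ge 2$, let $G_m=\prod_k \mathbb Z/m_k\mathbb Z$ with its normalized Haar measure $\mu$ (the product of the uniform measures), and let $M_0=1$, $M_{k+1}=m_kM_k$. Write $n=\sum_k n_kM_k$ with $0\le n_k<m_k$, and let $\psi_n(x)=\prod_k \exp(2\pi i\,n_kx_k/m_k)$ be the Vilenkin system. Let $F_n$ be the $\sigma$-algebra generated by the sets $I_n(x)=\{y: y_j=x_j,\ j<n\}$. For $0<p<\infty$, $H_p$ is the space of all (complex) martingales $f=(f^{(n)})_{n\ge0}$ with respect to $(F_n)$ with $\|f\|_{H_p}:=\big\|\sup_n|f^{(n)}|\big\|_p<\infty$. Put $\widehat f(i)=\lim_{k\to\infty}\int f^{(k)}\overline{\psi_i}\,d\mu$, $S_nf=\sum_{k<n}\widehat f(k)\psi_k$, $l_n=\sum_{k=1}^n 1/k$ and $R_nf=\frac1{l_n}\sum_{k=1}^n\frac{S_kf}{k}$ (Riesz' logarithmic means). Let $\|g\|_{p,\infty}=\sup_{t>0}t\,\mu(|g|>t)^{1/p}$. An operator $T$ is bounded from $H_p$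 to a quasi-normed space $X$ if there is a finite constant $C$ such that $\|Tf\|_X\le C\|f\|_{H_p}$ for all $f\in H_p$. **Theorem 3.** Let $0<p<1/2$. (a) The maximal operator $f\mapsto\sup_{n\ge1}\dfrac{\log(n+1)\,|R_nf|}{(n+1)^{1/p-2}}$ is bounded from $H_p$ to $L_p$. (b) Let $\varphi:\{1,2,\dots\}\to[1,\infty)$ be a nondecreasing function such that $$\limsup_{n\to\infty}\frac{(n+1)^{1/p-2}}{\log(n+1)\,\varphi(n)}=+\infty .$$ Then the maximal operator $f\mapsto\sup_{n\ge1}\dfrac{|R_nf|}{\varphi(n)}$ is not bounded from $H_p$ to weak $L_{p,\infty}$. -/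

import Mathlib

open MeasureTheory Filter Topology
open scoped ENNReal NNReal

noncomputable section

namespace Vilenkin

/-- The Vilenkin group `G_m`: the complete direct product of the groups `ℤ/m_kℤ`. -/
abbrev G (m : ℕ → ℕ) : Type := ∀ k, ZMod (m k)

/-- The product `μ` of the measures `μ_k` on `ℤ/m_kℤ` with `μ_k {j} = 1 / m_k`. -/
def haar (m : ℕ → ℕ) : Measure (G m) :=
  Measure.infinitePi fun k => ((m k : ℝ≥0∞)⁻¹) • (Measure.count : Measure (ZMod (m k)))

/-- If all `m_k` are positive, each factor is a probability measure, hence so is the product. -/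
theorem isProbabilityMeasure_haar {m : ℕ → ℕ} (hm : ∀ k, 2 ≤ m k) :
    IsProbabilityMeasure (haar m) := by
  have : ∀ k, IsProbabilityMeasure
      (((m k : ℝ≥0∞)⁻¹) • (Measure.count : Measure (ZMod (m k)))) := by
    intro k
    have h2 := hm k
    have : NeZero (m k) := ⟨by omega⟩
    refine ⟨?_⟩
    rw [Measure.smul_apply, Measure.count_apply MeasurableSet.univ, Set.encard_univ,
      ENat.card_eq_coe_fintype_card, ZMod.card, smul_eq_mul]
    exact ENNReal.inv_mul_cancel (by simp; omega) (by simp)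
  unfold haar
  infer_instance

/-- The interval `I_n(x)`: all `y` with `y_0 = x_0, …, y_{n-1} = x_{n-1}`. -/
def cyl {m : ℕ → ℕ} (n : ℕ) (x : G m) : Set (G m) := {y | ∀ k < n, y k = x k}

theorem countable_range_cyl (m : ℕ → ℕ) (n : ℕ) :
    (Set.range (cyl n : G m → Set (G m))).Countable := by
  have hfac : Function.FactorsThrough (cyl n : G m → Set (G m))
      (fun x (k : Fin n) => x k) := by
    intro x y h
    ext z
    refine forall₂_congr fun k hk => ?_
    have := congrFun h ⟨k, hk⟩
    simp only at this
    rw [this]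
  obtain ⟨g, hg⟩ := (Function.factorsThrough_iff _).1 hfac
  have : ∀ k, Countable (ZMod (m k)) := fun k => by
    cases h : m k with
    | zero => exact inferInstanceAs (Countable ℤ)
    | succ j => exact inferInstanceAs (Countable (Fin (j + 1)))
  rw [hg]
  exact (Set.countable_range g).mono (Set.range_comp_subset_range _ _)

/-- The filtration `(F_n)`: `F_n` is the `σ`-algebra generated by the intervals `I_n(x)`. -/
def filtration (m : ℕ → ℕ) : Filtration ℕ (inferInstance : MeasurableSpace (G m)) where
  seq n := MeasurableSpace.generateFrom (Set.range (cyl n))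
  mono' := by
    intro i j hij
    refine MeasurableSpace.generateFrom_le ?_
    rintro _ ⟨x, rfl⟩
    have h : (cyl i x : Set (G m)) = ⋃₀ (cyl j '' cyl i x) := by
      ext y
      simp only [Set.mem_sUnion, Set.mem_image, exists_exists_and_eq_and]
      refine ⟨fun hy => ⟨y, hy, fun _ _ => rfl⟩, ?_⟩
      rintro ⟨z, hz, hyz⟩ k hk
      rw [hyz k (lt_of_lt_of_le hk hij), hz k hk]
    rw [h]
    refine MeasurableSet.sUnion ((countable_range_cyl m j).mono (Set.image_subset_range _ _)) ?_
    rintro _ ⟨z, -, rfl⟩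
    exact MeasurableSpace.measurableSet_generateFrom ⟨z, rfl⟩
  le' := by
    intro n
    refine MeasurableSpace.generateFrom_le ?_
    rintro _ ⟨x, rfl⟩
    have h : (cyl n x : Set (G m)) = ⋂ k, ⋂ (_ : k < n), (fun y : G m => y k) ⁻¹' {x k} := by
      ext y; simp [cyl]
    rw [h]
    exact MeasurableSet.iInter fun k => MeasurableSet.iInter fun _ =>
      (measurable_pi_apply k) (measurableSet_singleton _)

/-- `M_0 = 1`, `M_{k+1} = m_k M_k`. -/
def M (m : ℕ → ℕ) : ℕ → ℕ
  | 0 => 1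
  | k + 1 => m k * M m k

/-- The `k`-th digit `n_k` of `n = ∑ n_k M_k`, `0 ≤ n_k < m_k`. -/
def digit (m : ℕ → ℕ) (n k : ℕ) : ℕ := n / M m k % m k

/-- The generalized Rademacher functions `r_k(x) = exp(2πi x_k / m_k)`. -/
def rademacher (m : ℕ → ℕ) (k : ℕ) (x : G m) : ℂ :=
  Complex.exp (2 * Real.pi * Complex.I * ((x k).val : ℂ) / (m k : ℂ))

/-- The Vilenkin system `ψ_n = ∏_k r_k ^ n_k`. The product is finite: as `M_k ≥ 2 ^ k > n` for
`k ≥ n`, the digits `n_k` with `k ≥ n` vanish. -/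
def psi (m : ℕ → ℕ) (n : ℕ) (x : G m) : ℂ :=
  ∏ k ∈ Finset.range n, rademacher m k x ^ digit m n k

/-- `f = (f^(n))` is a martingale with respect to `(F_n)`. -/
def IsMart (m : ℕ → ℕ) (f : ℕ → G m → ℂ) : Prop :=
  Martingale f (filtration m) (haar m)

/-- The maximal function `f^* = sup_n |f^(n)|` of a martingale. -/
def maximal {m : ℕ → ℕ} (f : ℕ → G m → ℂ) (x : G m) : ℝ≥0∞ := ⨆ n, ‖f n x‖ₑ

/-- `‖f‖_{H_p} = ‖f^*‖_p`. -/
def hardyNorm (m : ℕ → ℕ) (p : ℝ) (f : ℕ → G m → ℂ) : ℝ≥0∞ :=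
  eLpNorm (maximal f) (ENNReal.ofReal p) (haar m)

/-- The martingale Hardy space `H_p(G_m)`. -/
def MemHardy (m : ℕ → ℕ) (p : ℝ) (f : ℕ → G m → ℂ) : Prop :=
  IsMart m f ∧ hardyNorm m p f < ∞

/-- The quasi-norm `‖g‖_{p,∞} = sup_{t > 0} t μ(g > t)^{1/p}` of a nonnegative function `g`. -/
def weakNorm (m : ℕ → ℕ) (p : ℝ) (g : G m → ℝ≥0∞) : ℝ≥0∞ :=
  ⨆ t : ℝ≥0, (t : ℝ≥0∞) * haar m {x | (t : ℝ≥0∞) < g x} ^ (1 / p)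

/-- The Vilenkin-Fourier coefficients of a martingale (the sequence is eventually constant). -/
def coeff {m : ℕ → ℕ} (f : ℕ → G m → ℂ) (i : ℕ) : ℂ :=
  limUnder atTop fun k : ℕ => ∫ x, f k x * (starRingEnd ℂ) (psi m i x) ∂(haar m)

/-- The partial sums `S_n f = ∑_{k < n} f̂(k) ψ_k`. -/
def partialSum {m : ℕ → ℕ} (n : ℕ) (f : ℕ → G m → ℂ) (x : G m) : ℂ :=
  ∑ k ∈ Finset.range n, coeff f k * psi m k x

/-- `l_n = ∑_{k=1}^n 1/k`. -/
def ell (n : ℕ) : ℝ := ∑ k ∈ Finset.Icc 1 n, 1 / (k : ℝ)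

/-- Riesz' logarithmic means `R_n f = (1 / l_n) ∑_{k=1}^n S_k f / k`. -/
def riesz {m : ℕ → ℕ} (n : ℕ) (f : ℕ → G m → ℂ) (x : G m) : ℂ :=
  1 / (ell n : ℂ) * ∑ k ∈ Finset.Icc 1 n, partialSum k f x / (k : ℂ)

/-- The maximal operator `sup_{n ≥ 1} log(n+1) |R_n f| / (n+1)^{1/p-2}`. -/
def rieszMaxP {m : ℕ → ℕ} (p : ℝ) (f : ℕ → G m → ℂ) (x : G m) : ℝ≥0∞ :=
  ⨆ n : ℕ+, ENNReal.ofReal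
    (Real.log ((n : ℝ) + 1) * ‖riesz n f x‖ / ((n : ℝ) + 1) ^ (1 / p - 2))

/-- The maximal operator `sup_{n ≥ 1} |R_n f| / φ(n)`. -/
def rieszMaxWeight {m : ℕ → ℕ} (φ : ℕ+ → ℝ) (f : ℕ → G m → ℂ) (x : G m) : ℝ≥0∞ :=
  ⨆ n : ℕ+, ENNReal.ofReal (‖riesz n f x‖ / φ n)

end Vilenkin

end

namespace Vilenkin

variable {m : ℕ → ℕ}

/-! ### Arithmetic of the generalized powers and digits -/

/-! Let `B` bound the `m k` and put `α = 1/p - 2 > 0`.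

Part (a). Since `log (n + 1) ≤ l_n`, the logarithm only cancels the normalization of `R_n`. Cut the
sum of `S_k f / k` into blocks `M_i ≤ k < M_{i+1}`, on which `(n + 1)^(-α) ≤ M_i^(-α)`. A block is
the convolution of `f^(i+1)` with a piece of the logarithmic kernel. If `a < b` are the first two
nonzero coordinates of `x`, the sums of Dirichlet kernels at `x` cancel up to order `M_a M_b`, and
Abel summation against `1/k` gives `O(M_a M_b / M_i)` (`exists_norm_blockKernel_le`).

No cancellation of `f` is needed, and no atoms. The running maximum of `|f^(k)|` is dominated by a
sum of adapted jumps that at least double, so the `p`-th powers of the jumps sum to at most a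
constant times `(f^*)^p` (`exists_tsum_jump_rpow_le`). A jump at time `j` is constant on cells of
level `j`, so everything is bounded by a positive combination of indicators of translated spikes. As
`p ≤ 1`, `p`-th powers may be taken term by term. What remains is that the total weight received by
the jump at time `j` is bounded uniformly in `j` (`exists_sum_cellWeight_le`); this is a geometric
sum, convergent because `p < 1/2`.

Part (b). Test on `M_N r_N 1_{I_N(0)}`. Its first nonzero coefficient is at `M_N` and equals `1`, so
for `n = M_N + 1` only the last partial sum survives and `|R_n f| = 1 / (n l_n)` everywhere, while
the `H_p` norm is at most `M_N^(1 - 1/p)`. Boundedness would force `M_N^(1/p - 2) ≤ C log n · φ(n)`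
along these `n`; monotonicity of `φ` and boundedness of `m` extend this to all large `n`. -/

theorem M_succ (n : ℕ) : M m (n + 1) = m n * M m n := rfl

theorem M_pos (hm : ∀ k, 2 ≤ m k) (n : ℕ) : 0 < M m n := by
  induction n with
  | zero => exact Nat.one_pos
  | succ n ih => exact Nat.mul_pos (by have := hm n; omega) ih

theorem two_mul_M_le (hm : ∀ k, 2 ≤ m k) (n : ℕ) : 2 * M m n ≤ M m (n + 1) :=
  Nat.mul_le_mul_right _ (hm n)

theorem monotone_M (hm : ∀ k, 2 ≤ m k) : Monotone (M m) :=
  monotone_nat_of_le_succ fun n => by have := two_mul_M_le hm n; omega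

theorem M_dvd_M {a b : ℕ} (h : a ≤ b) : M m a ∣ M m b := by
  induction b, h using Nat.le_induction with
  | base => exact dvd_rfl
  | succ b _ ih => exact ih.mul_left _

theorem lt_M (hm : ∀ k, 2 ≤ m k) (n : ℕ) : n < M m n := by
  induction n with
  | zero => exact Nat.one_pos
  | succ n ih => have := two_mul_M_le hm n; omega

theorem digit_eq_zero {n k : ℕ} (h : n < M m k) : digit m n k = 0 := by
  simp [digit, Nat.div_eq_of_lt h]

theorem digit_add_of_lt (hm : ∀ k, 2 ≤ m k) (a j : ℕ) {n k : ℕ} (hk : k < n) :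
    digit m (a * M m n + j) k = digit m j k := by
  obtain ⟨c, hc⟩ : M m (k + 1) ∣ M m n := M_dvd_M hk
  rw [digit, digit, hc, M_succ,
    show a * (m k * M m k * c) + j = j + M m k * (m k * (a * c)) by ring,
    Nat.add_mul_div_left _ _ (M_pos hm k), Nat.add_mul_mod_self_left]

theorem digit_add_of_le (hm : ∀ k, 2 ≤ m k) (a : ℕ) {j n k : ℕ} (hj : j < M m n) (hk : n ≤ k) :
    digit m (a * M m n + j) k = digit m (a * M m n) k := by
  obtain ⟨c, hc⟩ : M m n ∣ M m k := M_dvd_M hk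
  rw [digit, digit, hc, ← Nat.div_div_eq_div_mul, ← Nat.div_div_eq_div_mul,
    Nat.mul_div_cancel _ (M_pos hm n), add_comm, Nat.add_mul_div_right _ _ (M_pos hm n),
    Nat.div_eq_of_lt hj, zero_add]

/-! ### The Vilenkin functions -/

/-- Identification with a primitive character of `ZMod (m k)`, from which multiplicativity and
orthogonality are inherited. -/
theorem rademacher_eq (hm : ∀ k, 2 ≤ m k) (k : ℕ) (x : G m) :
    haveI : NeZero (m k) := ⟨by have := hm k; omega⟩
    rademacher m k x = ZMod.stdAddChar (x k) := by
  have : NeZero (m k) := ⟨by have := hm k; omega⟩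
  rw [ZMod.stdAddChar_apply, ZMod.toCircle_apply, rademacher]

theorem psi_eq_prod (hm : ∀ k, 2 ≤ m k) {n N : ℕ} (h : n < M m N) (x : G m) :
    psi m n x = ∏ k ∈ Finset.range N, rademacher m k x ^ digit m n k := by
  have key : ∀ {a b : ℕ}, a ≤ b → n < M m a →
      ∏ k ∈ Finset.range a, rademacher m k x ^ digit m n k =
        ∏ k ∈ Finset.range b, rademacher m k x ^ digit m n k := by
    intro a b hab ha
    refine Finset.prod_subset (Finset.range_mono hab) fun k _ hk => ?_
    rw [digit_eq_zero (ha.trans_le (monotone_M hm (by simpa using hk))), pow_zero]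
  rw [psi, key (le_max_left n N) (lt_M hm n), key (le_max_right n N) h]

/-- The digits of `a * M m n` and of `j` occupy disjoint positions, so there is no carry. All block
structure of the kernels comes from this. -/
theorem psi_add (hm : ∀ k, 2 ≤ m k) (a : ℕ) {j n : ℕ} (hj : j < M m n) (x : G m) :
    psi m (a * M m n + j) x = psi m (a * M m n) x * psi m j x := by
  have h := lt_M hm (a * M m n + j)
  rw [psi_eq_prod hm h, psi_eq_prod hm (N := a * M m n + j) (by omega),
    psi_eq_prod hm (n := j) (N := a * M m n + j) (by omega), ← Finset.prod_mul_distrib]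
  refine Finset.prod_congr rfl fun k _ => ?_
  rcases lt_or_ge k n with hk | hk
  · have h0 : digit m (a * M m n) k = 0 := by
      have := digit_add_of_lt hm a 0 hk
      rw [add_zero] at this
      rw [this, digit_eq_zero (M_pos hm k)]
    rw [digit_add_of_lt hm a j hk, h0, pow_zero, one_mul]
  · rw [digit_add_of_le hm a hj hk, digit_eq_zero (hj.trans_le (monotone_M hm hk)), pow_zero,
      mul_one]

theorem psi_mul_M (hm : ∀ k, 2 ≤ m k) {c l : ℕ} (hc : c < m l) (x : G m) :
    psi m (c * M m l) x = rademacher m l x ^ c := by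
  have h : c * M m l < M m (l + 1) := Nat.mul_lt_mul_of_pos_right hc (M_pos hm l)
  rw [psi_eq_prod hm h, Finset.prod_range_succ, Finset.prod_eq_one, one_mul]
  · rw [digit, Nat.mul_div_cancel _ (M_pos hm l), Nat.mod_eq_of_lt hc]
  · intro k hk
    have := digit_add_of_lt hm c 0 (Finset.mem_range.1 hk)
    rw [add_zero] at this
    rw [this, digit_eq_zero (M_pos hm k), pow_zero]

@[simp] theorem psi_zero (x : G m) : psi m 0 x = 1 := by simp [psi]

theorem norm_rademacher (k : ℕ) (x : G m) : ‖rademacher m k x‖ = 1 := by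
  rw [rademacher, show 2 * (Real.pi : ℂ) * Complex.I * ((x k).val : ℂ) / (m k : ℂ)
    = ((2 * Real.pi * (x k).val / m k : ℝ) : ℂ) * Complex.I by push_cast; ring,
    Complex.norm_exp_ofReal_mul_I]

theorem norm_psi (n : ℕ) (x : G m) : ‖psi m n x‖ = 1 := by
  simp [psi, norm_rademacher]

theorem rademacher_sub (hm : ∀ k, 2 ≤ m k) (k : ℕ) (x t : G m) :
    rademacher m k (x - t) = rademacher m k x * (starRingEnd ℂ) (rademacher m k t) := by
  have : NeZero (m k) := ⟨by have := hm k; omega⟩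
  rw [rademacher_eq hm, rademacher_eq hm, ← Complex.inv_eq_conj (norm_rademacher k t),
    rademacher_eq hm, Pi.sub_apply,
    AddChar.map_sub_eq_div, div_eq_mul_inv]

theorem psi_sub (hm : ∀ k, 2 ≤ m k) (n : ℕ) (x t : G m) :
    psi m n (x - t) = psi m n x * (starRingEnd ℂ) (psi m n t) := by
  simp only [psi, rademacher_sub hm, map_prod, map_pow, mul_pow, Finset.prod_mul_distrib]

theorem sum_rademacher_pow (hm : ∀ k, 2 ≤ m k) {l : ℕ} {x : G m} (hx : x l ≠ 0) :
    ∑ c ∈ Finset.range (m l), rademacher m l x ^ c = 0 := by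
  have : NeZero (m l) := ⟨by have := hm l; omega⟩
  have h1 : rademacher m l x ≠ 1 := by
    rw [rademacher_eq hm]
    intro h
    exact hx (ZMod.injective_stdAddChar (by rw [h, AddChar.map_zero_eq_one]))
  have h2 : rademacher m l x ^ m l = 1 := by
    rw [rademacher_eq hm, ← AddChar.map_nsmul_eq_pow]
    simp
  rw [geom_sum_eq h1, h2, sub_self, zero_div]

/-! ### Dirichlet kernels and their partial sums -/

/-- The Dirichlet kernel `D_n = ∑_{j < n} ψ_j`. -/
noncomputable def dirichlet (m : ℕ → ℕ) (n : ℕ) (x : G m) : ℂ := ∑ j ∈ Finset.range n, psi m j x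

theorem norm_dirichlet_le (n : ℕ) (x : G m) : ‖dirichlet m n x‖ ≤ n :=
  (norm_sum_le _ _).trans (by simp [norm_psi])

theorem dirichlet_add (hm : ∀ k, 2 ≤ m k) (a : ℕ) {j n : ℕ} (hj : j ≤ M m n) (x : G m) :
    dirichlet m (a * M m n + j) x =
      dirichlet m (a * M m n) x + psi m (a * M m n) x * dirichlet m j x := by
  rw [dirichlet, Finset.sum_range_add, dirichlet, dirichlet, Finset.mul_sum]
  congr 1
  exact Finset.sum_congr rfl fun i hi => psi_add hm a ((Finset.mem_range.1 hi).trans_le hj) x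

theorem dirichlet_mul_M (hm : ∀ k, 2 ≤ m k) (a n : ℕ) (x : G m) :
    dirichlet m (a * M m n) x =
      (∑ c ∈ Finset.range a, psi m (c * M m n) x) * dirichlet m (M m n) x := by
  induction a with
  | zero => simp [dirichlet]
  | succ a ih => rw [add_mul, one_mul, dirichlet_add hm a le_rfl, ih, Finset.sum_range_succ, add_mul]

theorem sum_psi_mul_M (hm : ∀ k, 2 ≤ m k) {l : ℕ} {x : G m} (hx : x l ≠ 0) :
    ∑ c ∈ Finset.range (m l), psi m (c * M m l) x = 0 := by
  rw [← sum_rademacher_pow hm hx]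
  exact Finset.sum_congr rfl fun c hc => psi_mul_M hm (Finset.mem_range.1 hc) x

/-- `M m (s + 1)` divides `M m n`, and the kernel of order `M m (s + 1)` contains the full character
sum over the `s`-th coordinate as a factor. -/
theorem dirichlet_mul_M_eq_zero (hm : ∀ k, 2 ≤ m k) {s n : ℕ} {x : G m} (hx : x s ≠ 0)
    (hsn : s < n) (a : ℕ) : dirichlet m (a * M m n) x = 0 := by
  obtain ⟨c, hc⟩ : M m (s + 1) ∣ M m n := M_dvd_M hsn
  rw [hc, show a * (M m (s + 1) * c) = a * c * M m (s + 1) by ring, dirichlet_mul_M hm, M_succ,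
    dirichlet_mul_M hm, sum_psi_mul_M hm hx, zero_mul, mul_zero]

theorem dirichlet_add_of_ne (hm : ∀ k, 2 ≤ m k) {s n j : ℕ} {x : G m} (hx : x s ≠ 0)
    (hsn : s < n) (a : ℕ) (hj : j ≤ M m n) :
    dirichlet m (a * M m n + j) x = psi m (a * M m n) x * dirichlet m j x := by
  rw [dirichlet_add hm a hj, dirichlet_mul_M_eq_zero hm hx hsn, zero_add]

/-- Complete blocks of length `M m (s + 1)` vanish, so only the remainder of `n` modulo this length
counts. -/
theorem norm_dirichlet_le_of_ne (hm : ∀ k, 2 ≤ m k) {s : ℕ} {x : G m} (hx : x s ≠ 0) (n : ℕ) :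
    ‖dirichlet m n x‖ ≤ M m (s + 1) := by
  have hlt := Nat.mod_lt n (M_pos hm (s + 1))
  rw [← Nat.div_add_mod' n (M m (s + 1)), dirichlet_add_of_ne hm hx (Nat.lt_succ_self s) _ hlt.le,
    norm_mul, norm_psi, one_mul]
  exact (norm_dirichlet_le _ _).trans (by exact_mod_cast hlt.le)

/-- The sum `∑_{k < n} D_k` of Dirichlet kernels. -/
noncomputable def dirichletSum (m : ℕ → ℕ) (n : ℕ) (x : G m) : ℂ :=
  ∑ k ∈ Finset.range n, dirichlet m k x

theorem dirichletSum_add (hm : ∀ k, 2 ≤ m k) {s n j : ℕ} {x : G m} (hx : x s ≠ 0)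
    (hsn : s < n) (a : ℕ) (hj : j ≤ M m n) :
    dirichletSum m (a * M m n + j) x =
      dirichletSum m (a * M m n) x + psi m (a * M m n) x * dirichletSum m j x := by
  rw [dirichletSum, Finset.sum_range_add, dirichletSum, dirichletSum, Finset.mul_sum]
  congr 1
  exact Finset.sum_congr rfl fun i hi =>
    dirichlet_add_of_ne hm hx hsn a ((Finset.mem_range.1 hi).le.trans hj)

theorem dirichletSum_mul_M (hm : ∀ k, 2 ≤ m k) {s n : ℕ} {x : G m} (hx : x s ≠ 0)
    (hsn : s < n) (a : ℕ) :
    dirichletSum m (a * M m n) x =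
      (∑ c ∈ Finset.range a, psi m (c * M m n) x) * dirichletSum m (M m n) x := by
  induction a with
  | zero => simp [dirichletSum]
  | succ a ih =>
    rw [add_mul, one_mul, dirichletSum_add hm hx hsn a le_rfl, ih, Finset.sum_range_succ, add_mul]

/-- The coordinate `s` makes `D_k` multiplicative over blocks; the second coordinate `l` then
annihilates sums over complete blocks of length `M m (l + 1)`. Fewer than `M m (l + 1)` terms
remain, each at most `M m (s + 1)`. -/
theorem norm_dirichletSum_le (hm : ∀ k, 2 ≤ m k) {s l : ℕ} {x : G m} (hs : x s ≠ 0)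
    (hl : x l ≠ 0) (hsl : s < l) (n : ℕ) :
    ‖dirichletSum m n x‖ ≤ M m (l + 1) * M m (s + 1) := by
  have h0 : dirichletSum m (n / M m (l + 1) * M m (l + 1)) x = 0 := by
    rw [dirichletSum_mul_M hm hs (hsl.trans (Nat.lt_succ_self l)), M_succ,
      dirichletSum_mul_M hm hs hsl, sum_psi_mul_M hm hl, zero_mul, mul_zero]
  have hlt := Nat.mod_lt n (M_pos hm (l + 1))
  rw [← Nat.div_add_mod' n (M m (l + 1)),
    dirichletSum_add hm hs (hsl.trans (Nat.lt_succ_self l)) _ hlt.le, h0, zero_add, norm_mul,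
    norm_psi, one_mul, dirichletSum]
  refine (norm_sum_le_of_le _ fun k _ => norm_dirichlet_le_of_ne hm hs k).trans ?_
  rw [Finset.sum_const, Finset.card_range, nsmul_eq_mul]
  gcongr

/-- Abel's inequality. -/
theorem norm_sum_Ico_mul_le {E : Type*} [SeminormedAddCommGroup E] [NormedSpace ℝ E] {w : ℕ → ℝ}
    {d : ℕ → E} {a : ℕ} {X : ℝ} (hw : ∀ k, a ≤ k → w (k + 1) ≤ w k) (hw0 : ∀ k, a ≤ k → 0 ≤ w k)
    (hd : ∀ b, a ≤ b → ‖∑ k ∈ Finset.Ico a b, d k‖ ≤ X) {b : ℕ} (hab : a ≤ b) :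
    ‖∑ k ∈ Finset.Ico a b, w k • d k‖ ≤ w a * X := by
  -- With the boundary term subtracted, the increments are `(w b - w (b + 1))` times a partial sum,
  -- and the bound telescopes.
  suffices h : ‖∑ k ∈ Finset.Ico a b, w k • d k - w b • ∑ k ∈ Finset.Ico a b, d k‖ ≤
      (w a - w b) * X by
    have h2 : ‖w b • ∑ k ∈ Finset.Ico a b, d k‖ ≤ w b * X := by
      rw [norm_smul, Real.norm_of_nonneg (hw0 b hab)]
      exact mul_le_mul_of_nonneg_left (hd b hab) (hw0 b hab)
    have h3 := norm_add_le_of_le h h2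
    rw [sub_add_cancel] at h3
    linarith
  induction b, hab using Nat.le_induction with
  | base => simp
  | succ b hab ih =>
    have e : ∑ k ∈ Finset.Ico a (b + 1), w k • d k -
        w (b + 1) • ∑ k ∈ Finset.Ico a (b + 1), d k =
        (∑ k ∈ Finset.Ico a b, w k • d k - w b • ∑ k ∈ Finset.Ico a b, d k) +
          (w b - w (b + 1)) • ∑ k ∈ Finset.Ico a (b + 1), d k := by
      rw [Finset.sum_Ico_succ_top hab, Finset.sum_Ico_succ_top hab]
      module
    rw [e]
    have h2 : ‖(w b - w (b + 1)) • ∑ k ∈ Finset.Ico a (b + 1), d k‖ ≤ (w b - w (b + 1)) * X := by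
      have := sub_nonneg.2 (hw b hab)
      rw [norm_smul, Real.norm_of_nonneg this]
      exact mul_le_mul_of_nonneg_left (hd _ (hab.trans (Nat.le_succ b))) this
    exact (norm_add_le_of_le ih h2).trans_eq (by ring)

/-! ### Pointwise bounds of the blocks of the logarithmic kernel -/

/-- The set of `x` whose coordinates below `b` vanish, except possibly the `a`-th one. -/
def spike (m : ℕ → ℕ) (a b : ℕ) : Set (G m) := {x | ∀ c < b, c ≠ a → x c = 0}

/-- The piece `∑ D_k / k` over `M_i ≤ k < min (M_{i+1}) n` of the logarithmic kernel. -/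
noncomputable def blockKernel (m : ℕ → ℕ) (i n : ℕ) (x : G m) : ℂ :=
  ∑ k ∈ Finset.Ico (M m i) (min (M m (i + 1)) n), dirichlet m k x / k

theorem M_succ_le {B : ℕ} (hB : ∀ k, m k ≤ B) (n : ℕ) : M m (n + 1) ≤ B * M m n :=
  Nat.mul_le_mul_right _ (hB n)

theorem norm_blockKernel_le_of_two (hm : ∀ k, 2 ≤ m k) {B : ℕ} (hB : ∀ k, m k ≤ B) (i n : ℕ)
    {s l : ℕ} {x : G m} (hs : x s ≠ 0) (hl : x l ≠ 0) (hsl : s < l) :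
    ‖blockKernel m i n x‖ ≤ 2 * (B : ℝ) ^ 2 / M m i * (M m s * M m l) := by
  have hMi : (0 : ℝ) < M m i := by exact_mod_cast M_pos hm i
  rcases le_or_gt (M m i) (min (M m (i + 1)) n) with hle | hlt
  swap
  · rw [blockKernel, Finset.Ico_eq_empty_of_le hlt.le, Finset.sum_empty, norm_zero]
    positivity
  -- The `2` in `X` arises because a sum over `Ico (M m i) b` is a difference of two values of
  -- `dirichletSum`.
  have key := norm_sum_Ico_mul_le (w := fun k : ℕ => (k : ℝ)⁻¹) (d := fun k => dirichlet m k x)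
    (a := M m i) (X := 2 * (M m (l + 1) * M m (s + 1))) (fun k hk => by
      have : (0 : ℝ) < k := by exact_mod_cast (M_pos hm i).trans_le hk
      have h2 : (k : ℝ) ≤ (k + 1 : ℕ) := by push_cast; linarith
      exact inv_anti₀ this h2) (fun k _ => by positivity) (fun b hb => by
      rw [Finset.sum_Ico_eq_sub _ hb]
      refine (norm_sub_le_of_le (norm_dirichletSum_le hm hs hl hsl b)
        (norm_dirichletSum_le hm hs hl hsl (M m i))).trans_eq (by ring)) hle
  have e : blockKernel m i n x =
      ∑ k ∈ Finset.Ico (M m i) (min (M m (i + 1)) n), (k : ℝ)⁻¹ • dirichlet m k x := by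
    refine Finset.sum_congr rfl fun k _ => ?_
    rw [Complex.real_smul, div_eq_inv_mul]
    push_cast; rfl
  rw [e]
  refine key.trans ?_
  have h1 : (M m (l + 1) : ℝ) ≤ B * M m l := by exact_mod_cast M_succ_le hB l
  have h2 : (M m (s + 1) : ℝ) ≤ B * M m s := by exact_mod_cast M_succ_le hB s
  calc ((M m i : ℝ))⁻¹ * (2 * (M m (l + 1) * M m (s + 1)))
      ≤ ((M m i : ℝ))⁻¹ * (2 * ((B * M m l) * (B * M m s))) := by gcongr
    _ = _ := by ring

/-- A block has at most `B * M m i` terms, each with weight at most `1 / M m i`. This serves the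
points with fewer than two nonzero coordinates up to `i`. -/
theorem norm_blockKernel_le_of_forall (hm : ∀ k, 2 ≤ m k) {B : ℕ} (hB : ∀ k, m k ≤ B) (i n : ℕ)
    {x : G m} {X : ℝ} (hX : ∀ k < M m (i + 1), ‖dirichlet m k x‖ ≤ X) :
    ‖blockKernel m i n x‖ ≤ B * X := by
  have hMi : (0 : ℝ) < M m i := by exact_mod_cast M_pos hm i
  have hX0 : 0 ≤ X := (norm_nonneg _).trans (hX 0 (M_pos hm _))
  have h1 : ‖blockKernel m i n x‖ ≤
      ∑ k ∈ Finset.Ico (M m i) (min (M m (i + 1)) n), X / M m i := by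
    refine norm_sum_le_of_le _ fun k hk => ?_
    rw [Finset.mem_Ico] at hk
    rw [norm_div, Complex.norm_natCast]
    have : (M m i : ℝ) ≤ k := by exact_mod_cast hk.1
    exact div_le_div₀ hX0 (hX k (by omega)) hMi this
  refine h1.trans ?_
  rw [Finset.sum_const, nsmul_eq_mul, Nat.card_Ico]
  have h2 : ((min (M m (i + 1)) n - M m i : ℕ) : ℝ) ≤ B * M m i := by
    have := M_succ_le hB i
    exact_mod_cast (by omega)
  calc _ ≤ B * M m i * (X / M m i) := by gcongr
    _ = B * X := by field_simp

/-- A pointwise bound of the pieces of the logarithmic kernel: at `x`, it is determined by the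
positions `a ≤ b` of the first two nonzero coordinates, cut off at `i`. -/
theorem exists_norm_blockKernel_le (hm : ∀ k, 2 ≤ m k) {B : ℕ} (hB : ∀ k, m k ≤ B) (i n : ℕ)
    (x : G m) : ∃ a b, a ≤ b ∧ b ≤ i ∧ x ∈ spike m a b ∧
      ‖blockKernel m i n x‖ ≤ 2 * (B : ℝ) ^ 2 / M m i * (M m a * M m b) := by
  classical
  have hMi : (0 : ℝ) < M m i := by exact_mod_cast M_pos hm i
  have hB1 : (1 : ℝ) ≤ B := by
    have := (hm 0).trans (hB 0)
    exact_mod_cast (by omega)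
  by_cases h1 : ∃ s, s ≤ i ∧ x s ≠ 0
  · set s := Nat.find h1
    obtain ⟨hsi, hs⟩ : s ≤ i ∧ x s ≠ 0 := Nat.find_spec h1
    have hmin : ∀ c < s, x c = 0 := fun c hc => by
      by_contra h
      exact Nat.find_min h1 hc ⟨hc.le.trans hsi, h⟩
    by_cases h2 : ∃ l, s < l ∧ l ≤ i ∧ x l ≠ 0
    · set l := Nat.find h2
      obtain ⟨hsl, hli, hl⟩ : s < l ∧ l ≤ i ∧ x l ≠ 0 := Nat.find_spec h2
      refine ⟨s, l, hsl.le, hli, fun c hc hcs => ?_, norm_blockKernel_le_of_two hm hB i n hs hl hsl⟩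
      rcases lt_or_gt_of_ne hcs with h | h
      · exact hmin c h
      · by_contra h3
        exact Nat.find_min h2 hc ⟨h, by omega, h3⟩
    -- With a single nonzero coordinate the trivial bound is already of the claimed form: for `b =
    -- i` the factor `M m b / M m i` is one.
    · refine ⟨s, i, hsi, le_rfl, fun c hc hcs => ?_, ?_⟩
      · rcases lt_or_gt_of_ne hcs with h | h
        · exact hmin c h
        · by_contra h3
          exact h2 ⟨c, h, hc.le, h3⟩
      · refine (norm_blockKernel_le_of_forall hm hB i n
          fun k _ => norm_dirichlet_le_of_ne hm hs k).trans ?_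
        have h3 : (M m (s + 1) : ℝ) ≤ B * M m s := by exact_mod_cast M_succ_le hB s
        calc (B : ℝ) * M m (s + 1) ≤ B * (B * M m s) := by gcongr
          _ ≤ 2 * (B * (B * M m s)) := by
            have : (0 : ℝ) ≤ B * (B * M m s) := by positivity
            linarith
          _ = 2 * (B : ℝ) ^ 2 / M m i * (M m s * M m i) := by field_simp
  · refine ⟨i, i, le_rfl, le_rfl, fun c hc _ => ?_, ?_⟩
    · by_contra h3
      exact h1 ⟨c, hc.le, h3⟩
    · refine (norm_blockKernel_le_of_forall hm hB i n (X := M m (i + 1))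
          fun k hk => (norm_dirichlet_le k x).trans (by exact_mod_cast hk.le)).trans ?_
      have h3 : (M m (i + 1) : ℝ) ≤ B * M m i := by exact_mod_cast M_succ_le hB i
      calc (B : ℝ) * M m (i + 1) ≤ B * (B * M m i) := by gcongr
        _ ≤ 2 * (B * (B * M m i)) := by
          have : (0 : ℝ) ≤ B * (B * M m i) := by positivity
          linarith
        _ = 2 * (B : ℝ) ^ 2 / M m i * (M m i * M m i) := by field_simp

/-! ### Cells and functions of finitely many coordinates -/

/-- `u` depends only on the first `n` coordinates. -/
def IsLevel {α : Type*} (n : ℕ) (u : G m → α) : Prop := ∀ x y, y ∈ cyl n x → u y = u x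

theorem mem_cyl_self (n : ℕ) (x : G m) : x ∈ cyl n x := fun _ _ => rfl

theorem cyl_anti {a b : ℕ} (h : a ≤ b) (x : G m) : cyl b x ⊆ cyl a x :=
  fun _ hy k hk => hy k (hk.trans_le h)

theorem IsLevel.mono {α : Type*} {a b : ℕ} {u : G m → α} (hu : IsLevel a u) (h : a ≤ b) :
    IsLevel b u := fun x y hy => hu x y (cyl_anti h x hy)

theorem IsLevel.comp {α β : Type*} {n : ℕ} {u : G m → α} (hu : IsLevel n u) (g : α → β) :
    IsLevel n (fun x => g (u x)) := fun x y h => congrArg g (hu x y h)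

theorem measurableSet_cyl_filtration (n : ℕ) (x : G m) :
    MeasurableSet[filtration m n] (cyl n x) :=
  MeasurableSpace.measurableSet_generateFrom ⟨x, rfl⟩

theorem measurableSet_cyl (n : ℕ) (x : G m) : MeasurableSet (cyl n x) :=
  (filtration m).le n _ (measurableSet_cyl_filtration n x)

theorem mem_iff_mem_of_mem_cyl {n : ℕ} {S : Set (G m)} (hS : MeasurableSet[filtration m n] S)
    {x y : G m} (h : y ∈ cyl n x) : y ∈ S ↔ x ∈ S := by
  induction S, hS using MeasurableSpace.generateFrom_induction with
  | hC S hS _ =>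
    obtain ⟨z, rfl⟩ := hS
    exact forall₂_congr fun k hk => by rw [h k hk]
  | empty => simp
  | compl S _ ih => exact not_congr ih
  | iUnion S _ ih => simp only [Set.mem_iUnion]; exact exists_congr ih

theorem isLevel_of_measurable {α : Type*} [MeasurableSpace α] [MeasurableSingletonClass α] {n : ℕ}
    {u : G m → α} (hu : Measurable[filtration m n] u) : IsLevel n u := fun x _ h =>
  (mem_iff_mem_of_mem_cyl (hu (measurableSet_singleton (u x))) h).2 rfl

/-- There are only countably many cells, so any preimage is a countable union of them, whatever the
σ-algebra of the target. -/
theorem IsLevel.measurable_filtration {α : Type*} [MeasurableSpace α] {n : ℕ} {u : G m → α}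
    (hu : IsLevel n u) : Measurable[filtration m n] u := by
  intro S _
  have h : u ⁻¹' S = ⋃₀ (cyl n '' (u ⁻¹' S)) := by
    ext y
    simp only [Set.mem_sUnion, Set.mem_image, exists_exists_and_eq_and]
    refine ⟨fun hy => ⟨y, hy, mem_cyl_self n y⟩, ?_⟩
    rintro ⟨z, hz, hyz⟩
    rw [Set.mem_preimage, hu z y hyz]
    exact hz
  rw [h]
  refine MeasurableSet.sUnion ((countable_range_cyl m n).mono (Set.image_subset_range _ _)) ?_
  rintro _ ⟨z, -, rfl⟩
  exact measurableSet_cyl_filtration n z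

theorem IsLevel.measurable {α : Type*} [MeasurableSpace α] {n : ℕ} {u : G m → α}
    (hu : IsLevel n u) : Measurable u :=
  hu.measurable_filtration.mono ((filtration m).le n) le_rfl

/-- The point with the given first `n` coordinates and all other coordinates zero. -/
def cellPoint (m : ℕ → ℕ) (n : ℕ) (q : ∀ k : Fin n, ZMod (m k)) : G m :=
  fun k => if h : k < n then q ⟨k, h⟩ else 0

theorem mem_cyl_cellPoint {n : ℕ} {q : ∀ k : Fin n, ZMod (m k)} {x : G m} :
    x ∈ cyl n (cellPoint m n q) ↔ (fun k : Fin n => x k) = q := by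
  constructor
  · intro h
    funext k
    rw [h k k.2]
    simp [cellPoint]
  · rintro rfl k hk
    simp [cellPoint, hk]

theorem iUnion_cyl_cellPoint (n : ℕ) :
    ⋃ q : ∀ k : Fin n, ZMod (m k), cyl n (cellPoint m n q) = Set.univ :=
  Set.eq_univ_of_forall fun x => Set.mem_iUnion.2 ⟨fun k => x k, mem_cyl_cellPoint.2 rfl⟩

theorem pairwise_disjoint_cyl_cellPoint (n : ℕ) :
    Pairwise (Function.onFun Disjoint
      fun q : ∀ k : Fin n, ZMod (m k) => cyl n (cellPoint m n q)) := fun _ _ hqq' =>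
  Set.disjoint_left.2 fun _ hx hx' =>
    hqq' ((mem_cyl_cellPoint.1 hx).symm.trans (mem_cyl_cellPoint.1 hx'))

theorem M_eq_prod (n : ℕ) : M m n = ∏ k ∈ Finset.range n, m k := by
  induction n with
  | zero => rfl
  | succ n ih => rw [M_succ, Finset.prod_range_succ, ih, mul_comm]

theorem haar_cyl (hm : ∀ k, 2 ≤ m k) (n : ℕ) (x : G m) :
    haar m (cyl n x) = (M m n : ℝ≥0∞)⁻¹ := by
  have hprob : ∀ k, IsProbabilityMeasure
      (((m k : ℝ≥0∞)⁻¹) • (Measure.count : Measure (ZMod (m k)))) := by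
    intro k
    have h2 := hm k
    have : NeZero (m k) := ⟨by omega⟩
    refine ⟨?_⟩
    rw [Measure.smul_apply, Measure.count_apply MeasurableSet.univ, Set.encard_univ,
      ENat.card_eq_coe_fintype_card, ZMod.card, smul_eq_mul]
    exact ENNReal.inv_mul_cancel (by simp; omega) (by simp)
  have h : cyl n x = Set.pi (Finset.range n : Set ℕ) fun k => {x k} := by
    ext y; simp [cyl, Set.mem_pi]
  rw [h, haar, Measure.infinitePi_pi _ (fun _ _ => measurableSet_singleton _), M_eq_prod,
    Nat.cast_prod, ENNReal.prod_inv_distrib]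
  · refine Finset.prod_congr rfl fun k _ => ?_
    rw [Measure.smul_apply, Measure.count_singleton, smul_eq_mul, mul_one]
  · intro i _ j _ _
    exact Or.inr (by simp)

theorem lintegral_eq_sum_cells [∀ k, NeZero (m k)] (n : ℕ) (u : G m → ℝ≥0∞) :
    ∫⁻ x, u x ∂haar m =
      ∑ q : ∀ k : Fin n, ZMod (m k), ∫⁻ x in cyl n (cellPoint m n q), u x ∂haar m := by
  rw [← tsum_fintype (L := .unconditional _), ← lintegral_iUnion (fun q => measurableSet_cyl n _)
    (pairwise_disjoint_cyl_cellPoint n), iUnion_cyl_cellPoint, Measure.restrict_univ]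

theorem setLIntegral_cyl_mul {n : ℕ} {u : G m → ℝ≥0∞} (hu : IsLevel n u) {v : G m → ℝ≥0∞}
    (hv : Measurable v) (x : G m) :
    ∫⁻ t in cyl n x, u t * v t ∂haar m = u x * ∫⁻ t in cyl n x, v t ∂haar m := by
  rw [← lintegral_const_mul _ hv]
  exact setLIntegral_congr_fun (measurableSet_cyl n x) fun t ht => by
    simp only [hu x t ht]

theorem lintegral_level [∀ k, NeZero (m k)] (hm : ∀ k, 2 ≤ m k) {n : ℕ} {u : G m → ℝ≥0∞}
    (hu : IsLevel n u) :
    ∑ q : ∀ k : Fin n, ZMod (m k), u (cellPoint m n q) = M m n * ∫⁻ x, u x ∂haar m := by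
  have hM : (M m n : ℝ≥0∞) ≠ 0 := by exact_mod_cast (M_pos hm n).ne'
  rw [lintegral_eq_sum_cells n, Finset.mul_sum]
  refine Finset.sum_congr rfl fun q _ => ?_
  have := setLIntegral_cyl_mul hu (v := fun _ => 1) measurable_const (cellPoint m n q)
  simp only [mul_one] at this
  rw [this, setLIntegral_one, haar_cyl hm, mul_comm, mul_assoc,
    ENNReal.inv_mul_cancel hM (ENNReal.natCast_ne_top _), mul_one]

theorem isLevel_psi {n j : ℕ} (hm : ∀ k, 2 ≤ m k) (hj : j < M m n) : IsLevel n (psi m j) := by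
  intro x y h
  rw [psi_eq_prod hm hj, psi_eq_prod hm hj]
  refine Finset.prod_congr rfl fun k hk => ?_
  rw [rademacher, rademacher, h k (Finset.mem_range.1 hk)]

/-! ### Translated spikes: measures and convolution with functions of finite level -/

theorem mem_cyl_sub {n : ℕ} {x y z : G m} (h : y ∈ cyl n x) : z - y ∈ cyl n (z - x) :=
  fun k hk => by rw [Pi.sub_apply, Pi.sub_apply, h k hk]

theorem mem_cyl_sub_right {n : ℕ} {x y z : G m} (h : y ∈ cyl n x) : y - z ∈ cyl n (x - z) :=
  fun k hk => by rw [Pi.sub_apply, Pi.sub_apply, h k hk]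

theorem spike_iff_of_mem_cyl {a b : ℕ} {x y : G m} (h : y ∈ cyl b x) :
    y ∈ spike m a b ↔ x ∈ spike m a b :=
  forall₂_congr fun c hc => by rw [h c hc]

theorem haar_iUnion_cyl_le [∀ k, NeZero (m k)] (hm : ∀ k, 2 ≤ m k) {B : ℕ} (hB : ∀ k, m k ≤ B)
    (a b : ℕ) (z : ZMod (m a) → G m) :
    haar m (⋃ c, cyl b (z c)) ≤ B * (M m b : ℝ≥0∞)⁻¹ := by
  refine (measure_iUnion_fintype_le _ _).trans ?_
  simp only [haar_cyl hm, Finset.sum_const, Finset.card_univ, ZMod.card, nsmul_eq_mul]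
  gcongr
  exact hB a

/-- Only the coordinate `a` is free below `b`, so at most `m a ≤ B` cylinders of level `b` cover the
set. -/
theorem haar_sub_mem_spike_le [∀ k, NeZero (m k)] (hm : ∀ k, 2 ≤ m k) {B : ℕ}
    (hB : ∀ k, m k ≤ B) (a b : ℕ) (q : G m) :
    haar m {x | x - q ∈ spike m a b} ≤ B * (M m b : ℝ≥0∞)⁻¹ := by
  refine (measure_mono fun x hx => ?_).trans
    (haar_iUnion_cyl_le hm hB a b fun c => q + Pi.single a c)
  refine Set.mem_iUnion.2 ⟨x a - q a, fun k hk => ?_⟩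
  by_cases hka : k = a
  · subst hka; simp
  · have := hx k hk hka
    rw [Pi.sub_apply, sub_eq_zero] at this
    simp [hka, this]

theorem haar_mem_spike_sub_le [∀ k, NeZero (m k)] (hm : ∀ k, 2 ≤ m k) {B : ℕ}
    (hB : ∀ k, m k ≤ B) (a b : ℕ) (x : G m) :
    haar m {t | x - t ∈ spike m a b} ≤ B * (M m b : ℝ≥0∞)⁻¹ := by
  refine (measure_mono fun t ht => ?_).trans
    (haar_iUnion_cyl_le hm hB a b fun c => x - Pi.single a c)
  refine Set.mem_iUnion.2 ⟨x a - t a, fun k hk => ?_⟩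
  by_cases hka : k = a
  · subst hka; simp
  · have := ht k hk hka
    rw [Pi.sub_apply, sub_eq_zero] at this
    simp [hka, this]

/-- On the cell, `x - t` and `x - q` agree in the first `n` coordinates, so a nonempty intersection
forces `x - q` into the truncated spike. The measure is then governed by the finer of the two
levels. -/
theorem haar_cyl_inter_le [∀ k, NeZero (m k)] (hm : ∀ k, 2 ≤ m k) {B : ℕ} (hB : ∀ k, m k ≤ B)
    (a b n : ℕ) (x q : G m) :
    haar m (cyl n q ∩ {t | x - t ∈ spike m a b}) ≤ B * (M m (max n b) : ℝ≥0∞)⁻¹ *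
      (spike m (min a n) (min b n)).indicator 1 (x - q) := by
  by_cases h : x - q ∈ spike m (min a n) (min b n)
  · rw [Set.indicator_of_mem h, Pi.one_apply, mul_one]
    rcases le_total n b with hnb | hbn
    · rw [max_eq_right hnb]
      exact (measure_mono Set.inter_subset_right).trans (haar_mem_spike_sub_le hm hB a b x)
    · rw [max_eq_left hbn]
      refine (measure_mono Set.inter_subset_left).trans ?_
      rw [haar_cyl hm]
      have : (1 : ℝ≥0∞) ≤ B := by
        have := (hm 0).trans (hB 0)
        exact_mod_cast (by omega)
      exact le_mul_of_one_le_left' this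
  · have : cyl n q ∩ {t | x - t ∈ spike m a b} = ∅ := by
      refine Set.eq_empty_of_forall_notMem fun t ht => h fun c hc hca => ?_
      have hcn : c < n := by omega
      -- Because `c < n`, the condition `c ≠ min a n` already excludes `c = a`.
      have := ht.2 c (by omega) (by omega)
      rw [Pi.sub_apply, ht.1 c hcn] at this
      exact this
    rw [this, measure_empty]
    exact zero_le

theorem measurable_indicator_spike_sub (a b : ℕ) (q : G m) :
    Measurable fun x => (spike m a b).indicator (1 : G m → ℝ≥0∞) (x - q) := by
  refine IsLevel.measurable (n := b) fun x y h => ?_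
  have e := spike_iff_of_mem_cyl (a := a) (mem_cyl_sub_right (z := q) h)
  by_cases hx : x - q ∈ spike m a b
  · simp [hx, e.2 hx]
  · simp [hx, mt e.1 hx]

theorem measurable_indicator_sub_spike (a b : ℕ) (x : G m) :
    Measurable fun t => (spike m a b).indicator (1 : G m → ℝ≥0∞) (x - t) := by
  refine IsLevel.measurable (n := b) fun t y h => ?_
  have e := spike_iff_of_mem_cyl (a := a) (mem_cyl_sub (z := x) h)
  by_cases hx : x - t ∈ spike m a b
  · simp [hx, e.2 hx]
  · simp [hx, mt e.1 hx]

/-- Splitting into the cells on which `u` is constant yields a finite sum of indicators in `x`, a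
form in which `p`-th powers can be taken termwise even though `p < 1`. -/
theorem lintegral_mul_indicator_spike_le [∀ k, NeZero (m k)] (hm : ∀ k, 2 ≤ m k) {B : ℕ}
    (hB : ∀ k, m k ≤ B) (a b : ℕ) {n : ℕ} {u : G m → ℝ≥0∞} (hu : IsLevel n u) (x : G m) :
    ∫⁻ t, u t * (spike m a b).indicator 1 (x - t) ∂haar m ≤
      ∑ q : ∀ k : Fin n, ZMod (m k), u (cellPoint m n q) * (B * (M m (max n b) : ℝ≥0∞)⁻¹ *
        (spike m (min a n) (min b n)).indicator 1 (x - cellPoint m n q)) := by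
  rw [lintegral_eq_sum_cells n]
  refine Finset.sum_le_sum fun q _ => ?_
  rw [setLIntegral_cyl_mul hu (measurable_indicator_sub_spike a b x)]
  gcongr
  refine le_trans ?_ (haar_cyl_inter_le hm hB a b n x (cellPoint m n q))
  have hms : MeasurableSet {t : G m | x - t ∈ spike m a b} := by
    have h := (measurable_indicator_sub_spike a b x) (measurableSet_singleton 1)
    convert h using 1
    ext t
    by_cases ht : x - t ∈ spike m a b <;> simp [ht]
  have e : (fun t => (spike m a b).indicator (1 : G m → ℝ≥0∞) (x - t)) =
      {t : G m | x - t ∈ spike m a b}.indicator 1 := by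
    ext t
    by_cases ht : x - t ∈ spike m a b
    · rw [Set.indicator_of_mem ht, Set.indicator_of_mem (by exact ht)]; rfl
    · rw [Set.indicator_of_notMem ht, Set.indicator_of_notMem (by exact ht)]
  rw [e, lintegral_indicator_one hms, Measure.restrict_apply hms, Set.inter_comm]

/-! ### Jumps of the running maximum -/

/-- A nondecreasing majorant of a sequence that at least doubles whenever it changes. -/
noncomputable def envelope (h : ℕ → ℝ≥0∞) : ℕ → ℝ≥0∞
  | 0 => 0
  | n + 1 => if h n ≤ envelope h n then envelope h n else 2 * h n

/-- The value to which the envelope jumps at time `n`, or zero if it does not jump. -/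
noncomputable def jump (h : ℕ → ℝ≥0∞) (n : ℕ) : ℝ≥0∞ :=
  if h n ≤ envelope h n then 0 else 2 * h n

theorem envelope_congr {h h' : ℕ → ℝ≥0∞} {n : ℕ} (e : ∀ k < n, h k = h' k) :
    envelope h n = envelope h' n := by
  induction n with
  | zero => rfl
  | succ n ih =>
    rw [envelope, envelope, ih fun k hk => e k (hk.trans (Nat.lt_succ_self n)),
      e n (Nat.lt_succ_self n)]

theorem jump_congr {h h' : ℕ → ℝ≥0∞} {n : ℕ} (e : ∀ k ≤ n, h k = h' k) :
    jump h n = jump h' n := by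
  rw [jump, jump, envelope_congr fun k hk => e k hk.le, e n le_rfl]

theorem envelope_le_sum_jump (h : ℕ → ℝ≥0∞) (n : ℕ) :
    envelope h n ≤ ∑ j ∈ Finset.range n, jump h j := by
  induction n with
  | zero => simp [envelope]
  | succ n ih =>
    rw [envelope, Finset.sum_range_succ, jump]
    split_ifs
    · simpa using ih
    · exact le_add_self

/-- At a time without a jump the old envelope dominates `h n`; at a jump the new one is `2 * h n`.
-/
theorem le_sum_jump (h : ℕ → ℝ≥0∞) (n : ℕ) : h n ≤ ∑ j ∈ Finset.range (n + 1), jump h j := by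
  refine le_trans ?_ (envelope_le_sum_jump h (n + 1))
  rw [envelope]
  split_ifs with h1
  · exact h1
  · rw [two_mul]; exact le_self_add

theorem envelope_le (h : ℕ → ℝ≥0∞) (n : ℕ) : envelope h n ≤ 2 * ⨆ k, h k := by
  induction n with
  | zero => simp [envelope]
  | succ n ih =>
    rw [envelope]
    split_ifs
    · exact ih
    · gcongr; exact le_iSup h n

/-- Each jump at least doubles the envelope, so the `p`-th powers form a series dominated
geometrically by its last term, and the envelope never exceeds `2 * ⨆ k, h k`. -/
theorem exists_tsum_jump_rpow_le {p : ℝ} (hp : 0 < p) :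
    ∃ C : ℝ≥0, ∀ h : ℕ → ℝ≥0∞, ∑' n, jump h n ^ p ≤ C * (⨆ k, h k) ^ p := by
  have h2 : (1 / 2 : ℝ) ^ p < 1 := Real.rpow_lt_one (by norm_num) (by norm_num) hp
  -- The fixed point of `c ↦ c / 2 ^ p + 1`, which makes the induction below reproduce itself.
  set c : ℝ := (1 - (1 / 2 : ℝ) ^ p)⁻¹
  have hc0 : 0 < c := inv_pos.2 (sub_pos.2 h2)
  have hc : c * (1 / 2 : ℝ) ^ p + 1 = c := by
    have : c * (1 - (1 / 2 : ℝ) ^ p) = 1 := inv_mul_cancel₀ (sub_pos.2 h2).ne'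
    linarith
  have hcE : ENNReal.ofReal c * (1 / 2 : ℝ≥0∞) ^ p + 1 = ENNReal.ofReal c := by
    have e : (1 / 2 : ℝ≥0∞) ^ p = ENNReal.ofReal ((1 / 2 : ℝ) ^ p) := by
      rw [← ENNReal.ofReal_rpow_of_pos (by norm_num)]
      congr 1
      rw [ENNReal.ofReal_div_of_pos two_pos]
      simp
    rw [e, ← ENNReal.ofReal_mul hc0.le, ← ENNReal.ofReal_one,
      ← ENNReal.ofReal_add (by positivity) zero_le_one, hc]
  have key : ∀ (h : ℕ → ℝ≥0∞) (n : ℕ),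
      ∑ j ∈ Finset.range n, jump h j ^ p ≤ ENNReal.ofReal c * envelope h n ^ p := by
    intro h n
    induction n with
    | zero => simp
    | succ n ih =>
      rw [Finset.sum_range_succ, envelope, jump]
      split_ifs with h1
      · rw [ENNReal.zero_rpow_of_pos hp, add_zero]; exact ih
      · have h3 : envelope h n ≤ 1 / 2 * (2 * h n) := by
          rw [← mul_assoc, one_div, ENNReal.inv_mul_cancel two_ne_zero ENNReal.ofNat_ne_top,
            one_mul]
          exact (not_le.1 h1).le
        calc _ ≤ ENNReal.ofReal c * (1 / 2 * (2 * h n)) ^ p + (2 * h n) ^ p := by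
              gcongr; exact ih.trans (by gcongr)
          _ = (ENNReal.ofReal c * (1 / 2 : ℝ≥0∞) ^ p + 1) * (2 * h n) ^ p := by
              rw [ENNReal.mul_rpow_of_nonneg _ _ hp.le]; ring
          _ = _ := by rw [hcE]
  refine ⟨c.toNNReal * 2 ^ p, fun h => ENNReal.tsum_le_of_sum_range_le fun n => ?_⟩
  refine (key h n).trans ?_
  rw [ENNReal.coe_mul, ENNReal.coe_rpow_of_nonneg _ hp.le, mul_assoc, ENNReal.coe_ofNat,
    ← ENNReal.mul_rpow_of_nonneg _ _ hp.le]
  change _ ≤ ENNReal.ofReal c * _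
  gcongr
  exact envelope_le h n

/-! ### Geometric sums of powers of `M_n` -/

theorem M_rpow_le (hm : ∀ k, 2 ≤ m k) {r : ℝ} (hr : 0 < r) (n : ℕ) :
    (M m n : ℝ) ^ r ≤ (1 / 2 : ℝ) ^ r * (M m (n + 1) : ℝ) ^ r := by
  rw [← Real.mul_rpow (by norm_num) (by positivity)]
  have : (2 : ℝ) * M m n ≤ M m (n + 1) := by exact_mod_cast two_mul_M_le hm n
  exact Real.rpow_le_rpow (by positivity) (by linarith) hr.le

theorem exists_sum_M_rpow_le (hm : ∀ k, 2 ≤ m k) {r : ℝ} (hr : 0 < r) :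
    ∃ C : ℝ, 0 ≤ C ∧ ∀ n, ∑ a ∈ Finset.range (n + 1), (M m a : ℝ) ^ r ≤ C * (M m n : ℝ) ^ r := by
  have h2 : (1 / 2 : ℝ) ^ r < 1 := Real.rpow_lt_one (by norm_num) (by norm_num) hr
  set c : ℝ := (1 - (1 / 2 : ℝ) ^ r)⁻¹
  have hc0 : 0 < c := inv_pos.2 (sub_pos.2 h2)
  have hc : c * (1 / 2 : ℝ) ^ r + 1 = c := by
    have : c * (1 - (1 / 2 : ℝ) ^ r) = 1 := inv_mul_cancel₀ (sub_pos.2 h2).ne'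
    linarith
  refine ⟨c, hc0.le, fun n => ?_⟩
  induction n with
  | zero =>
    have : 0 ≤ c * (1 / 2 : ℝ) ^ r := by positivity
    simp [M]; linarith
  | succ n ih =>
    rw [Finset.sum_range_succ]
    calc _ ≤ c * ((1 / 2 : ℝ) ^ r * (M m (n + 1) : ℝ) ^ r) + (M m (n + 1) : ℝ) ^ r := by
          gcongr; exact ih.trans (by gcongr; exact M_rpow_le hm hr n)
      _ = (c * (1 / 2 : ℝ) ^ r + 1) * (M m (n + 1) : ℝ) ^ r := by ring
      _ = _ := by rw [hc]

theorem exists_sum_M_rpow_neg_le (hm : ∀ k, 2 ≤ m k) {r : ℝ} (hr : 0 < r) :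
    ∃ C : ℝ, 0 ≤ C ∧ ∀ n N, ∑ a ∈ Finset.Ico n N, (M m a : ℝ) ^ (-r) ≤ C * (M m n : ℝ) ^ (-r) := by
  have h2 : (1 / 2 : ℝ) ^ r < 1 := Real.rpow_lt_one (by norm_num) (by norm_num) hr
  set c : ℝ := (1 - (1 / 2 : ℝ) ^ r)⁻¹
  have hc0 : 0 < c := inv_pos.2 (sub_pos.2 h2)
  have hc : c * (1 - (1 / 2 : ℝ) ^ r) = 1 := inv_mul_cancel₀ (sub_pos.2 h2).ne'
  refine ⟨c, hc0.le, fun n N => ?_⟩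
  rcases le_or_gt n N with hnN | hnN
  swap
  · rw [Finset.Ico_eq_empty_of_le hnN.le, Finset.sum_empty]; positivity
  -- Sharpened to a telescoping form so that the induction on `N` closes with a constant independent
  -- of `N`.
  suffices h : ∑ a ∈ Finset.Ico n N, (M m a : ℝ) ^ (-r) ≤
      c * ((M m n : ℝ) ^ (-r) - (M m N : ℝ) ^ (-r)) by
    have : 0 ≤ c * (M m N : ℝ) ^ (-r) := by positivity
    linarith
  induction N, hnN using Nat.le_induction with
  | base => simp
  | succ N hN ih =>
    rw [Finset.sum_Ico_succ_top hN]
    have hM : (0 : ℝ) < M m N := by exact_mod_cast M_pos hm N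
    have hM' : (0 : ℝ) < M m (N + 1) := by exact_mod_cast M_pos hm (N + 1)
    have h3 : (M m (N + 1) : ℝ) ^ (-r) ≤ (1 / 2 : ℝ) ^ r * (M m N : ℝ) ^ (-r) := by
      have := M_rpow_le hm hr N
      rw [Real.rpow_neg hM.le, Real.rpow_neg hM'.le, inv_le_iff_one_le_mul₀ (by positivity)]
      have hpos : (0 : ℝ) < (M m N : ℝ) ^ r := by positivity
      calc (1 : ℝ) = ((M m N : ℝ) ^ r)⁻¹ * (M m N : ℝ) ^ r := by field_simp
        _ ≤ ((M m N : ℝ) ^ r)⁻¹ * ((1 / 2 : ℝ) ^ r * (M m (N + 1) : ℝ) ^ r) := by gcongr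
        _ = _ := by ring
    have h4 : (M m N : ℝ) ^ (-r) ≤ c * ((M m N : ℝ) ^ (-r) - (M m (N + 1) : ℝ) ^ (-r)) :=
      calc (M m N : ℝ) ^ (-r) = c * (1 - (1 / 2 : ℝ) ^ r) * (M m N : ℝ) ^ (-r) := by
            rw [hc, one_mul]
        _ = c * ((M m N : ℝ) ^ (-r) - (1 / 2 : ℝ) ^ r * (M m N : ℝ) ^ (-r)) := by ring
        _ ≤ _ := by gcongr
    linarith

/-! ### Fourier coefficients and partial sums of martingales -/

theorem integrable_mul_conj_psi {f : G m → ℂ} (hm : ∀ k, 2 ≤ m k)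
    (hf : Integrable f (haar m)) (j : ℕ) :
    Integrable (fun x => f x * (starRingEnd ℂ) (psi m j x)) (haar m) :=
  hf.mul_bdd (c := 1)
    (((isLevel_psi hm (lt_M hm j)).comp (starRingEnd ℂ)).measurable.aestronglyMeasurable)
    (Eventually.of_forall fun x => by rw [RCLike.norm_conj, norm_psi])

/-- `psi m j` is measurable with respect to `F_n`, so it can be pulled out of the conditional
expectation of `f k`. -/
theorem integral_mul_conj_psi_eq (hm : ∀ k, 2 ≤ m k) {f : ℕ → G m → ℂ} (hf : IsMart m f)
    {j n k : ℕ} (hj : j < M m n) (hnk : n ≤ k) :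
    ∫ x, f k x * (starRingEnd ℂ) (psi m j x) ∂haar m =
      ∫ x, f n x * (starRingEnd ℂ) (psi m j x) ∂haar m := by
  have := isProbabilityMeasure_haar hm
  have h1 := condExp_bilin_of_stronglyMeasurable_right (μ := haar m) (m := filtration m n)
    (ContinuousLinearMap.mul ℝ ℂ) (f := f k) (g := fun x => (starRingEnd ℂ) (psi m j x))
    ((isLevel_psi hm hj).comp (starRingEnd ℂ)).measurable_filtration.stronglyMeasurable
    (integrable_mul_conj_psi hm (hf.integrable k) j) (hf.integrable k)
  have h2 := hf.condExp_ae_eq hnk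
  simp only [ContinuousLinearMap.mul_apply'] at h1
  rw [← integral_condExp ((filtration m).le n)]
  refine integral_congr_ae ?_
  filter_upwards [h1, h2] with x hx1 hx2
  rw [hx1, hx2]

theorem coeff_eq (hm : ∀ k, 2 ≤ m k) {f : ℕ → G m → ℂ} (hf : IsMart m f) {j n : ℕ}
    (hj : j < M m n) : coeff f j = ∫ x, f n x * (starRingEnd ℂ) (psi m j x) ∂haar m := by
  refine Tendsto.limUnder_eq (tendsto_const_nhds.congr' ?_)
  filter_upwards [eventually_ge_atTop n] with k hk
  exact (integral_mul_conj_psi_eq hm hf hj hk).symm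

theorem partialSum_eq_integral (hm : ∀ k, 2 ≤ m k) {f : ℕ → G m → ℂ} (hf : IsMart m f) {k n : ℕ}
    (hk : k ≤ M m n) (x : G m) :
    partialSum k f x = ∫ t, f n t * dirichlet m k (x - t) ∂haar m := by
  simp only [dirichlet, Finset.mul_sum, psi_sub hm]
  rw [integral_finsetSum]
  · refine Finset.sum_congr rfl fun j hj => ?_
    rw [coeff_eq hm hf ((Finset.mem_range.1 hj).trans_le hk), ← integral_mul_const]
    congr 1 with t
    ring
  · intro j _
    refine ((integrable_mul_conj_psi hm (hf.integrable n) j).mul_const (psi m j x)).congr ?_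
    exact Eventually.of_forall fun t => by simp only; ring

/-- All `k` in the block are below `M m (i + 1)`, so the single function `f (i + 1)` determines all
of these partial sums. -/
theorem sum_partialSum_eq_integral (hm : ∀ k, 2 ≤ m k) {f : ℕ → G m → ℂ} (hf : IsMart m f)
    (i n : ℕ) (x : G m) :
    ∑ k ∈ Finset.Ico (M m i) (min (M m (i + 1)) n), partialSum k f x / (k : ℂ) =
      ∫ t, f (i + 1) t * blockKernel m i n (x - t) ∂haar m := by
  simp only [blockKernel, Finset.mul_sum]
  rw [integral_finsetSum]
  · refine Finset.sum_congr rfl fun k hk => ?_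
    rw [Finset.mem_Ico] at hk
    rw [partialSum_eq_integral hm hf (n := i + 1) (by omega), ← integral_div]
    congr 1 with t
    ring
  · intro k _
    have h : Integrable (fun t => f (i + 1) t * dirichlet m k (x - t)) (haar m) := by
      simp only [dirichlet, Finset.mul_sum, psi_sub hm]
      refine integrable_finsetSum _ fun j _ => ?_
      refine ((integrable_mul_conj_psi hm (hf.integrable (i + 1)) j).mul_const (psi m j x)).congr ?_
      exact Eventually.of_forall fun t => by simp only; ring
    refine (h.div_const (k : ℂ)).congr ?_
    exact Eventually.of_forall fun t => by simp only; ring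

/-- The jump at time `n` of the running maximum of a martingale. -/
noncomputable def martJump (f : ℕ → G m → ℂ) (n : ℕ) (x : G m) : ℝ≥0∞ :=
  jump (fun k => ‖f k x‖ₑ) n

/-- Whether and how far the envelope jumps at time `n` depends only on `f 0, …, f n`. -/
theorem isLevel_martJump {f : ℕ → G m → ℂ} (hf : IsMart m f) (n : ℕ) :
    IsLevel n (martJump f n) := by
  intro x y h
  refine jump_congr fun k hk => ?_
  rw [isLevel_of_measurable (hf.stronglyMeasurable k).measurable x y (cyl_anti hk x h)]

/-- The pair `(a, b)` in the pointwise bound depends on `x`; summing over all pairs removes this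
dependence and leaves fixed coefficients on indicators. -/
theorem enorm_blockKernel_le (hm : ∀ k, 2 ≤ m k) {B : ℕ} (hB : ∀ k, m k ≤ B) (i n : ℕ)
    (x : G m) : ‖blockKernel m i n x‖ₑ ≤
      ∑ b ∈ Finset.range (i + 1), ∑ a ∈ Finset.range (b + 1),
        ENNReal.ofReal (2 * (B : ℝ) ^ 2 / M m i * (M m a * M m b)) *
          (spike m a b).indicator 1 x := by
  obtain ⟨a, b, hab, hbi, hx, h⟩ := exists_norm_blockKernel_le hm hB i n x
  calc ‖blockKernel m i n x‖ₑ = ENNReal.ofReal ‖blockKernel m i n x‖ := (ofReal_norm _).symm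
    _ ≤ ENNReal.ofReal (2 * (B : ℝ) ^ 2 / M m i * (M m a * M m b)) *
          (spike m a b).indicator 1 x := by
        rw [Set.indicator_of_mem hx, Pi.one_apply, mul_one]
        exact ENNReal.ofReal_le_ofReal h
    _ ≤ ∑ a ∈ Finset.range (b + 1), ENNReal.ofReal (2 * (B : ℝ) ^ 2 / M m i * (M m a * M m b)) *
          (spike m a b).indicator 1 x :=
        Finset.single_le_sum (f := fun a =>
          ENNReal.ofReal (2 * (B : ℝ) ^ 2 / M m i * (M m a * M m b)) *
          (spike m a b).indicator 1 x) (fun _ _ => zero_le)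
          (Finset.mem_range.2 (Nat.lt_succ_of_le hab))
    _ ≤ _ := Finset.single_le_sum (f := fun b => ∑ a ∈ Finset.range (b + 1),
          ENNReal.ofReal (2 * (B : ℝ) ^ 2 / M m i * (M m a * M m b)) *
          (spike m a b).indicator 1 x) (fun _ _ => zero_le)
          (Finset.mem_range.2 (Nat.lt_succ_of_le hbi))

theorem natCast_mul_inv_natCast (a : ℕ) {b : ℕ} (hb : 0 < b) :
    (a : ℝ≥0∞) * (b : ℝ≥0∞)⁻¹ = ENNReal.ofReal ((a : ℝ) / b) := by
  rw [ENNReal.ofReal_div_of_pos (by exact_mod_cast hb), ENNReal.ofReal_natCast,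
    ENNReal.ofReal_natCast, div_eq_mul_inv]

theorem enorm_block_le [∀ k, NeZero (m k)] (hm : ∀ k, 2 ≤ m k) {B : ℕ} (hB : ∀ k, m k ≤ B)
    {f : ℕ → G m → ℂ} (hf : IsMart m f) (i n : ℕ) (x : G m) :
    ‖∑ k ∈ Finset.Ico (M m i) (min (M m (i + 1)) n), partialSum k f x / (k : ℂ)‖ₑ ≤
      ∑ j ∈ Finset.range (i + 2), ∑ b ∈ Finset.range (i + 1), ∑ a ∈ Finset.range (b + 1),
        ∑ q : ∀ k : Fin j, ZMod (m k),
          ENNReal.ofReal (2 * (B : ℝ) ^ 2 / M m i * (M m a * M m b) * (B / M m (max j b))) *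
          martJump f j (cellPoint m j q) *
          (spike m (min a j) (min b j)).indicator 1 (x - cellPoint m j q) := by
  rw [sum_partialSum_eq_integral hm hf]
  refine (enorm_integral_le_lintegral_enorm _).trans ?_
  have hJm : ∀ j, Measurable (martJump f j) := fun j => (isLevel_martJump hf j).measurable
  calc ∫⁻ t, ‖f (i + 1) t * blockKernel m i n (x - t)‖ₑ ∂haar m
      ≤ ∫⁻ t, ∑ j ∈ Finset.range (i + 2), ∑ b ∈ Finset.range (i + 1),
          ∑ a ∈ Finset.range (b + 1),
          ENNReal.ofReal (2 * (B : ℝ) ^ 2 / M m i * (M m a * M m b)) *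
          (martJump f j t * (spike m a b).indicator 1 (x - t)) ∂haar m := by
        refine lintegral_mono fun t => ?_
        rw [enorm_mul]
        refine (mul_le_mul' (le_sum_jump (fun k => ‖f k t‖ₑ) (i + 1))
          (enorm_blockKernel_le hm hB i n (x - t))).trans_eq ?_
        rw [Finset.sum_mul]
        refine Finset.sum_congr rfl fun j _ => ?_
        rw [Finset.mul_sum]
        refine Finset.sum_congr rfl fun b _ => ?_
        rw [Finset.mul_sum]
        refine Finset.sum_congr rfl fun a _ => ?_
        rw [martJump]
        ring
    _ = ∑ j ∈ Finset.range (i + 2), ∑ b ∈ Finset.range (i + 1), ∑ a ∈ Finset.range (b + 1),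
          ENNReal.ofReal (2 * (B : ℝ) ^ 2 / M m i * (M m a * M m b)) *
          ∫⁻ t, martJump f j t * (spike m a b).indicator 1 (x - t) ∂haar m := by
        have hme : ∀ j a b, Measurable fun t =>
            martJump f j t * (spike m a b).indicator (1 : G m → ℝ≥0∞) (x - t) := fun j a b =>
          (hJm j).mul (measurable_indicator_sub_spike a b x)
        rw [lintegral_finsetSum _ fun j _ => Finset.measurable_fun_sum _ fun b _ =>
          Finset.measurable_fun_sum _ fun a _ => (hme j a b).const_mul _]
        refine Finset.sum_congr rfl fun j _ => ?_
        rw [lintegral_finsetSum _ fun b _ =>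
          Finset.measurable_fun_sum _ fun a _ => (hme j a b).const_mul _]
        refine Finset.sum_congr rfl fun b _ => ?_
        rw [lintegral_finsetSum _ fun a _ => (hme j a b).const_mul _]
        refine Finset.sum_congr rfl fun a _ => ?_
        rw [lintegral_const_mul _ (hme j a b)]
    _ ≤ _ := by
        refine Finset.sum_le_sum fun j _ => Finset.sum_le_sum fun b _ =>
          Finset.sum_le_sum fun a _ => ?_
        refine (mul_le_mul_right (lintegral_mul_indicator_spike_le hm hB a b
          (isLevel_martJump hf j) x) _).trans_eq ?_
        rw [Finset.mul_sum]
        refine Finset.sum_congr rfl fun q _ => ?_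
        rw [natCast_mul_inv_natCast _ (M_pos hm _), ENNReal.ofReal_mul (q := B / M m (max j b))
          (by positivity)]
        ring

/-! ### Bounds of the logarithmic means -/

theorem ell_eq_harmonic (n : ℕ) : ell n = harmonic n := by
  rw [ell, harmonic_eq_sum_Icc]
  push_cast
  simp

theorem log_add_one_le_ell (n : ℕ) : Real.log ((n : ℝ) + 1) ≤ ell n := by
  rw [ell_eq_harmonic]
  exact_mod_cast log_add_one_le_harmonic n

theorem ell_le_one_add_log (n : ℕ) : ell n ≤ 1 + Real.log n := by
  rw [ell_eq_harmonic]
  exact harmonic_le_one_add_log n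

theorem norm_riesz_eq (n : ℕ) (f : ℕ → G m → ℂ) (x : G m) :
    ‖riesz n f x‖ = (ell n)⁻¹ * ‖∑ k ∈ Finset.Icc 1 n, partialSum k f x / (k : ℂ)‖ := by
  have : 0 ≤ ell n := Finset.sum_nonneg fun k _ => by positivity
  rw [riesz, norm_mul, norm_div, norm_one, Complex.norm_real, Real.norm_of_nonneg this, one_div]

theorem sum_Icc_eq_sum_blocks (hm : ∀ k, 2 ≤ m k) {E : Type*} [AddCommMonoid E] (g : ℕ → E)
    (n : ℕ) : ∑ k ∈ Finset.Icc 1 n, g k =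
      ∑ i ∈ Finset.range (n + 1),
        ∑ k ∈ Finset.Ico (M m i) (min (M m (i + 1)) (n + 1)), g k := by
  have key : ∀ N, ∑ i ∈ Finset.range N,
      ∑ k ∈ Finset.Ico (M m i) (min (M m (i + 1)) (n + 1)), g k =
        ∑ k ∈ Finset.Ico 1 (min (M m N) (n + 1)), g k := by
    intro N
    induction N with
    | zero => simp [M]
    | succ N ih =>
      rw [Finset.sum_range_succ, ih]
      have h1 := M_pos hm N
      have h2 := two_mul_M_le hm N
      rcases le_total (M m N) (n + 1) with h | h
      · rw [min_eq_left h, Finset.sum_Ico_consecutive _ (by omega) (by omega)]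
      · rw [min_eq_right h, min_eq_right (by omega), Finset.Ico_eq_empty_of_le h,
          Finset.sum_empty, add_zero]
  rw [key, min_eq_right (lt_M hm (n + 1)).le]
  rfl

/-- The inequality `log (n + 1) ≤ ell n` removes the logarithm, and `M m i ≤ n + 1` on a nonempty
block makes the weight depend on the block alone. -/
theorem ofReal_log_mul_norm_riesz_le (hm : ∀ k, 2 ≤ m k) {α : ℝ} (hα : 0 ≤ α)
    (f : ℕ → G m → ℂ) (x : G m) {n : ℕ} (hn : 1 ≤ n) :
    ENNReal.ofReal (Real.log ((n : ℝ) + 1) * ‖riesz n f x‖ / ((n : ℝ) + 1) ^ α) ≤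
      ∑ i ∈ Finset.range (n + 1), ENNReal.ofReal ((M m i : ℝ) ^ (-α)) *
        ‖∑ k ∈ Finset.Ico (M m i) (min (M m (i + 1)) (n + 1)), partialSum k f x / (k : ℂ)‖ₑ := by
  have hlog : 0 < Real.log ((n : ℝ) + 1) := Real.log_pos (by
    have : (1 : ℝ) ≤ n := by exact_mod_cast hn
    linarith)
  have hell := log_add_one_le_ell n
  have h1 : Real.log ((n : ℝ) + 1) * ‖riesz n f x‖ / ((n : ℝ) + 1) ^ α ≤
      ((n : ℝ) + 1) ^ (-α) * ‖∑ k ∈ Finset.Icc 1 n, partialSum k f x / (k : ℂ)‖ := by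
    rw [norm_riesz_eq, Real.rpow_neg (by positivity), div_eq_inv_mul, ← mul_assoc (Real.log _)]
    gcongr
    refine mul_le_of_le_one_left (norm_nonneg _) ?_
    rw [← div_eq_mul_inv]
    exact (div_le_one (hlog.trans_le hell)).2 hell
  refine (ENNReal.ofReal_le_ofReal h1).trans ?_
  rw [ENNReal.ofReal_mul (by positivity), ofReal_norm, sum_Icc_eq_sum_blocks hm]
  refine (mul_le_mul_right (enorm_sum_le _ _) _).trans ?_
  rw [Finset.mul_sum]
  refine Finset.sum_le_sum fun i _ => ?_
  have hMi := M_pos hm i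
  rcases le_or_gt (M m i) (n + 1) with h | h
  · gcongr ENNReal.ofReal ?_ * _
    refine Real.rpow_le_rpow_of_nonpos (by exact_mod_cast hMi) (by exact_mod_cast h) (by linarith)
  · rw [Finset.Ico_eq_empty_of_le (by omega), Finset.sum_empty, enorm_zero, mul_zero, mul_zero]

/-- The coefficients that arise when the maximal operator is estimated on cells. -/
noncomputable def cellWeight (m : ℕ → ℕ) (B : ℕ) (p : ℝ) (i j b a : ℕ) : ℝ :=
  (M m i : ℝ) ^ (-(1 / p - 2)) *
    (2 * (B : ℝ) ^ 2 / M m i * (M m a * M m b) * (B / M m (max j b)))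

theorem cellWeight_nonneg (B : ℕ) (p : ℝ) (i j b a : ℕ) : 0 ≤ cellWeight m B p i j b a := by
  unfold cellWeight; positivity

/-- The bound of a block does not see where `n` truncates it, so one series over all blocks
dominates the supremum. -/
theorem rieszMaxP_le [∀ k, NeZero (m k)] (hm : ∀ k, 2 ≤ m k) {B : ℕ} (hB : ∀ k, m k ≤ B) {p : ℝ}
    (hp0 : 0 < p) (hp : p < 1 / 2) {f : ℕ → G m → ℂ} (hf : IsMart m f) (x : G m) :
    rieszMaxP p f x ≤ ∑' i, ∑ j ∈ Finset.range (i + 2), ∑ b ∈ Finset.range (i + 1),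
      ∑ a ∈ Finset.range (b + 1), ∑ q : ∀ k : Fin j, ZMod (m k),
        ENNReal.ofReal (cellWeight m B p i j b a) * martJump f j (cellPoint m j q) *
          (spike m (min a j) (min b j)).indicator 1 (x - cellPoint m j q) := by
  have hα : 0 ≤ 1 / p - 2 := by
    rw [sub_nonneg, le_div_iff₀ hp0]; linarith
  refine iSup_le fun n => (ofReal_log_mul_norm_riesz_le hm hα f x n.2).trans ?_
  refine (Finset.sum_le_sum fun i _ => ?_).trans (ENNReal.sum_le_tsum (Finset.range (n + 1)))
  refine (mul_le_mul_right (enorm_block_le hm hB hf i (n + 1) x) _).trans_eq ?_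
  simp only [Finset.mul_sum]
  refine Finset.sum_congr rfl fun j _ => Finset.sum_congr rfl fun b _ =>
    Finset.sum_congr rfl fun a _ => Finset.sum_congr rfl fun q _ => ?_
  rw [cellWeight, ENNReal.ofReal_mul (p := (M m i : ℝ) ^ _) (by positivity)]
  simp only [mul_assoc]

/-! ### Integrating `p`-th powers term by term -/

theorem rpow_finsetSum_le {ι : Type*} {p : ℝ} (hp0 : 0 < p) (hp1 : p ≤ 1) (s : Finset ι)
    (u : ι → ℝ≥0∞) : (∑ i ∈ s, u i) ^ p ≤ ∑ i ∈ s, u i ^ p :=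
  Finset.le_sum_of_subadditive (fun y : ℝ≥0∞ => y ^ p) (ENNReal.zero_rpow_of_pos hp0).le
    (fun y z => ENNReal.rpow_add_le_add_rpow y z hp0.le hp1) s u

theorem rpow_tsum_le {p : ℝ} (hp0 : 0 < p) (hp1 : p ≤ 1) (u : ℕ → ℝ≥0∞) :
    (∑' i, u i) ^ p ≤ ∑' i, u i ^ p := by
  rw [← ENNReal.le_rpow_inv_iff hp0]
  refine ENNReal.tsum_le_of_sum_range_le fun n => ?_
  rw [ENNReal.le_rpow_inv_iff hp0]
  exact (rpow_finsetSum_le hp0 hp1 _ _).trans (ENNReal.sum_le_tsum _)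

theorem lintegral_rieszMaxP_rpow_le [∀ k, NeZero (m k)] (hm : ∀ k, 2 ≤ m k) {B : ℕ}
    (hB : ∀ k, m k ≤ B) {p : ℝ} (hp0 : 0 < p) (hp : p < 1 / 2) {f : ℕ → G m → ℂ}
    (hf : IsMart m f) :
    ∫⁻ x, rieszMaxP p f x ^ p ∂haar m ≤ ∑' i, ∑ j ∈ Finset.range (i + 2),
      ENNReal.ofReal (M m j * ∑ b ∈ Finset.range (i + 1), ∑ a ∈ Finset.range (b + 1),
        cellWeight m B p i j b a ^ p * (B / M m (min b j))) *
          ∫⁻ x, martJump f j x ^ p ∂haar m := by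
  have hp1 : p ≤ 1 := by linarith
  have hind : ∀ (S : Set (G m)) (x : G m),
      (S.indicator (1 : G m → ℝ≥0∞) x) ^ p = S.indicator 1 x := fun S x => by
    by_cases hx : x ∈ S
    · simp [hx]
    · simp [hx, hp0]
  calc ∫⁻ x, rieszMaxP p f x ^ p ∂haar m
      ≤ ∫⁻ x, ∑' i, ∑ j ∈ Finset.range (i + 2), ∑ b ∈ Finset.range (i + 1),
      ∑ a ∈ Finset.range (b + 1), ∑ q : ∀ k : Fin j, ZMod (m k),
        ENNReal.ofReal (cellWeight m B p i j b a ^ p) * martJump f j (cellPoint m j q) ^ p *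
          (spike m (min a j) (min b j)).indicator 1 (x - cellPoint m j q) ∂haar m := by
        refine lintegral_mono fun x => ?_
        refine (ENNReal.rpow_le_rpow (rieszMaxP_le hm hB hp0 hp hf x) hp0.le).trans ?_
        refine (rpow_tsum_le hp0 hp1 _).trans (ENNReal.tsum_le_tsum fun i => ?_)
        refine (rpow_finsetSum_le hp0 hp1 _ _).trans (Finset.sum_le_sum fun j _ => ?_)
        refine (rpow_finsetSum_le hp0 hp1 _ _).trans (Finset.sum_le_sum fun b _ => ?_)
        refine (rpow_finsetSum_le hp0 hp1 _ _).trans (Finset.sum_le_sum fun a _ => ?_)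
        refine (rpow_finsetSum_le hp0 hp1 _ _).trans (Finset.sum_le_sum fun q _ => ?_)
        rw [ENNReal.mul_rpow_of_nonneg _ _ hp0.le, ENNReal.mul_rpow_of_nonneg _ _ hp0.le, hind,
          ENNReal.ofReal_rpow_of_nonneg (cellWeight_nonneg ..) hp0.le]
    _ = ∑' i, ∑ j ∈ Finset.range (i + 2), ∑ b ∈ Finset.range (i + 1),
      ∑ a ∈ Finset.range (b + 1), ∑ q : ∀ k : Fin j, ZMod (m k),
        ENNReal.ofReal (cellWeight m B p i j b a ^ p) * martJump f j (cellPoint m j q) ^ p *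
          ∫⁻ x, (spike m (min a j) (min b j)).indicator 1 (x - cellPoint m j q) ∂haar m := by
        have h0 := fun (j b a : ℕ) (q : ∀ k : Fin j, ZMod (m k)) =>
          measurable_indicator_spike_sub (min a j) (min b j) (cellPoint m j q)
        rw [lintegral_tsum fun i => (Finset.measurable_fun_sum _ fun j _ =>
          Finset.measurable_fun_sum _ fun b _ => Finset.measurable_fun_sum _ fun a _ =>
          Finset.measurable_fun_sum _ fun q _ => (h0 j b a q).const_mul _).aemeasurable]
        refine tsum_congr fun i => ?_
        rw [lintegral_finsetSum _ fun j _ =>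
          Finset.measurable_fun_sum _ fun b _ => Finset.measurable_fun_sum _ fun a _ =>
          Finset.measurable_fun_sum _ fun q _ => (h0 j b a q).const_mul _]
        refine Finset.sum_congr rfl fun j _ => ?_
        rw [lintegral_finsetSum _ fun b _ => Finset.measurable_fun_sum _ fun a _ =>
          Finset.measurable_fun_sum _ fun q _ => (h0 j b a q).const_mul _]
        refine Finset.sum_congr rfl fun b _ => ?_
        rw [lintegral_finsetSum _ fun a _ =>
          Finset.measurable_fun_sum _ fun q _ => (h0 j b a q).const_mul _]
        refine Finset.sum_congr rfl fun a _ => ?_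
        rw [lintegral_finsetSum _ fun q _ => (h0 j b a q).const_mul _]
        refine Finset.sum_congr rfl fun q _ => ?_
        rw [lintegral_const_mul _ (h0 j b a q)]
    _ ≤ ∑' i, ∑ j ∈ Finset.range (i + 2), ∑ b ∈ Finset.range (i + 1),
      ∑ a ∈ Finset.range (b + 1), ∑ q : ∀ k : Fin j, ZMod (m k),
        ENNReal.ofReal (cellWeight m B p i j b a ^ p * (B / M m (min b j))) *
          martJump f j (cellPoint m j q) ^ p := by
        refine ENNReal.tsum_le_tsum fun i => Finset.sum_le_sum fun j _ =>
          Finset.sum_le_sum fun b _ => Finset.sum_le_sum fun a _ =>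
          Finset.sum_le_sum fun q _ => ?_
        rw [ENNReal.ofReal_mul (Real.rpow_nonneg (cellWeight_nonneg ..) _), mul_right_comm,
          ← natCast_mul_inv_natCast _ (M_pos hm _)]
        gcongr
        refine le_trans ?_ (haar_sub_mem_spike_le hm hB (min a j) (min b j) (cellPoint m j q))
        have e : (fun x => (spike m (min a j) (min b j)).indicator (1 : G m → ℝ≥0∞)
            (x - cellPoint m j q)) =
            {x | x - cellPoint m j q ∈ spike m (min a j) (min b j)}.indicator fun _ => 1 := by
          ext x
          by_cases hx : x - cellPoint m j q ∈ spike m (min a j) (min b j)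
          · rw [Set.indicator_of_mem hx, Set.indicator_of_mem (by exact hx)]; rfl
          · rw [Set.indicator_of_notMem hx, Set.indicator_of_notMem (by exact hx)]
        rw [e]
        exact (lintegral_indicator_const_le _ _).trans_eq (one_mul _)
    _ = _ := by
        refine tsum_congr fun i => Finset.sum_congr rfl fun j _ => ?_
        -- The factor `M m j` enters here: summing a level-`j` function over the cells gives `M m j`
        -- times its integral.
        have hl := lintegral_level hm ((isLevel_martJump hf j).comp fun y => y ^ p)
        rw [mul_comm (M m j : ℝ), ENNReal.ofReal_mul
          (Finset.sum_nonneg fun b _ => Finset.sum_nonneg fun a _ => mul_nonneg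
            (Real.rpow_nonneg (cellWeight_nonneg ..) _) (by positivity)), ENNReal.ofReal_natCast,
          mul_assoc, ← hl, ENNReal.ofReal_sum_of_nonneg fun b _ => Finset.sum_nonneg fun a _ =>
            mul_nonneg (Real.rpow_nonneg (cellWeight_nonneg ..) _) (by positivity), Finset.sum_mul]
        refine Finset.sum_congr rfl fun b _ => ?_
        rw [ENNReal.ofReal_sum_of_nonneg fun a _ =>
            mul_nonneg (Real.rpow_nonneg (cellWeight_nonneg ..) _) (by positivity), Finset.sum_mul]
        refine Finset.sum_congr rfl fun a _ => ?_
        rw [Finset.mul_sum]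

/-! ### Uniform summability of the cell weights -/

theorem cellWeight_rpow_mul {B : ℕ} (hm : ∀ k, 2 ≤ m k) {p : ℝ} (hp0 : 0 < p) (i j b a : ℕ) :
    cellWeight m B p i j b a ^ p = (2 * (B : ℝ) ^ 3) ^ p * (M m i : ℝ) ^ (p - 1) *
      ((M m a : ℝ) ^ p * (M m b : ℝ) ^ p * (M m (max j b) : ℝ) ^ (-p)) := by
  have hi : (0 : ℝ) < M m i := by exact_mod_cast M_pos hm i
  have hx : (0 : ℝ) < M m (max j b) := by exact_mod_cast M_pos hm _
  have e : cellWeight m B p i j b a = 2 * (B : ℝ) ^ 3 * (M m i : ℝ) ^ (-(1 / p - 2) - 1) *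
      (M m a * M m b * (M m (max j b) : ℝ)⁻¹) := by
    rw [cellWeight, Real.rpow_sub_one hi.ne']
    field_simp
  rw [e, Real.mul_rpow (x := 2 * (B : ℝ) ^ 3 * _) (by positivity) (by positivity),
    Real.mul_rpow (x := 2 * (B : ℝ) ^ 3) (by positivity) (by positivity),
    Real.mul_rpow (x := (M m a * M m b : ℝ)) (by positivity) (by positivity),
    Real.mul_rpow (x := (M m a : ℝ)) (by positivity) (by positivity), ← Real.rpow_mul hi.le, Real.rpow_neg hx.le, Real.inv_rpow hx.le]
  congr 3
  field_simp
  ring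

/-- The two terms on the right are the values of the left side for `b ≤ j` and for `j ≤ b`; adding
them avoids splitting the sum over `b`. -/
theorem M_rpow_min_max_le (hm : ∀ k, 2 ≤ m k) (p : ℝ) (j b : ℕ) :
    (M m b : ℝ) ^ p * (M m b : ℝ) ^ p * (M m (max j b) : ℝ) ^ (-p) * (M m (min b j) : ℝ)⁻¹ ≤
      (M m b : ℝ) ^ (-(1 - 2 * p)) * (M m j : ℝ) ^ (-p) + (M m b : ℝ) ^ p * (M m j : ℝ)⁻¹ := by
  have hb : (0 : ℝ) < M m b := by exact_mod_cast M_pos hm b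
  have hj : (0 : ℝ) < M m j := by exact_mod_cast M_pos hm j
  rcases le_total j b with h | h
  · rw [max_eq_right h, min_eq_right h, Real.rpow_neg hb.le p, mul_inv_cancel_right₀ (by positivity)]
    exact le_add_of_nonneg_left (by positivity)
  · rw [max_eq_left h, min_eq_left h]
    refine le_of_eq_of_le ?_ (le_add_of_nonneg_right (by positivity))
    rw [show -(1 - 2 * p) = p + p - 1 by ring, Real.rpow_sub_one hb.ne', Real.rpow_add hb]
    ring

/-- After summation over `a` and `b` the block `i` contributes `(M_j / M_i)^(1 - p)` and `M_i^(2p -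
1)`, up to constants. Both are summable over `i ≥ j - 1`, the second because `p < 1/2`. The range
starts at `j - 1` since block `i` involves jumps up to time `i + 1`. -/
theorem exists_sum_cellWeight_le {B : ℕ} (hm : ∀ k, 2 ≤ m k) (hB : ∀ k, m k ≤ B) {p : ℝ}
    (hp0 : 0 < p) (hp : p < 1 / 2) : ∃ C : ℝ, 0 ≤ C ∧ ∀ j N, ∑ i ∈ Finset.Ico (j - 1) N,
      (M m j * ∑ b ∈ Finset.range (i + 1), ∑ a ∈ Finset.range (b + 1),
        cellWeight m B p i j b a ^ p * (B / M m (min b j))) ≤ C := by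
  obtain ⟨C₁, hC₁, h₁⟩ := exists_sum_M_rpow_le hm hp0
  obtain ⟨C₂, hC₂, h₂⟩ := exists_sum_M_rpow_neg_le hm (r := 1 - 2 * p) (by linarith)
  obtain ⟨C₃, hC₃, h₃⟩ := exists_sum_M_rpow_neg_le hm (r := 1 - p) (by linarith)
  set A : ℝ := (2 * (B : ℝ) ^ 3) ^ p * B * C₁
  have hA : 0 ≤ A := by positivity
  have hpos : ∀ k, (0 : ℝ) < M m k := fun k => by exact_mod_cast M_pos hm k
  have hone : ∀ k, (1 : ℝ) ≤ M m k := fun k => by exact_mod_cast M_pos hm k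
  have step : ∀ i j, (M m j * ∑ b ∈ Finset.range (i + 1), ∑ a ∈ Finset.range (b + 1),
        cellWeight m B p i j b a ^ p * (B / M m (min b j))) ≤
      A * (C₂ * ((M m i : ℝ) ^ (-(1 - p)) * (M m j : ℝ) ^ (1 - p)) +
        C₁ * (M m i : ℝ) ^ (-(1 - 2 * p))) := by
    intro i j
    have e1 : ∀ b, ∑ a ∈ Finset.range (b + 1),
        cellWeight m B p i j b a ^ p * (B / M m (min b j)) ≤
        A * (M m i : ℝ) ^ (-(1 - p)) * ((M m b : ℝ) ^ (-(1 - 2 * p)) * (M m j : ℝ) ^ (-p) +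
          (M m b : ℝ) ^ p * (M m j : ℝ)⁻¹) := by
      intro b
      calc ∑ a ∈ Finset.range (b + 1), cellWeight m B p i j b a ^ p * (B / M m (min b j))
          = (2 * (B : ℝ) ^ 3) ^ p * B * (M m i : ℝ) ^ (-(1 - p)) *
            ((∑ a ∈ Finset.range (b + 1), (M m a : ℝ) ^ p) * (M m b : ℝ) ^ p *
              (M m (max j b) : ℝ) ^ (-p) * (M m (min b j) : ℝ)⁻¹) := by
            simp only [Finset.sum_mul, Finset.mul_sum]
            refine Finset.sum_congr rfl fun a _ => ?_
            rw [cellWeight_rpow_mul hm hp0, neg_sub]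
            ring
        _ ≤ (2 * (B : ℝ) ^ 3) ^ p * B * (M m i : ℝ) ^ (-(1 - p)) *
            ((C₁ * (M m b : ℝ) ^ p) * (M m b : ℝ) ^ p *
              (M m (max j b) : ℝ) ^ (-p) * (M m (min b j) : ℝ)⁻¹) := by
            gcongr
            exact h₁ b
        _ = A * (M m i : ℝ) ^ (-(1 - p)) * ((M m b : ℝ) ^ p * (M m b : ℝ) ^ p *
              (M m (max j b) : ℝ) ^ (-p) * (M m (min b j) : ℝ)⁻¹) := by
            simp only [A]; ring
        _ ≤ _ := by
            gcongr
            exact M_rpow_min_max_le hm p j b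
    have e2 : ∑ b ∈ Finset.range (i + 1), (M m b : ℝ) ^ (-(1 - 2 * p)) ≤ C₂ := by
      have := h₂ 0 (i + 1)
      rw [← Finset.range_eq_Ico] at this
      simpa [M] using this
    calc (M m j * ∑ b ∈ Finset.range (i + 1), ∑ a ∈ Finset.range (b + 1),
        cellWeight m B p i j b a ^ p * (B / M m (min b j)))
        ≤ M m j * ∑ b ∈ Finset.range (i + 1), A * (M m i : ℝ) ^ (-(1 - p)) *
          ((M m b : ℝ) ^ (-(1 - 2 * p)) * (M m j : ℝ) ^ (-p) +
          (M m b : ℝ) ^ p * (M m j : ℝ)⁻¹) := by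
          gcongr with b _
          exact e1 b
      _ = A * (M m i : ℝ) ^ (-(1 - p)) * (M m j *
          ((∑ b ∈ Finset.range (i + 1), (M m b : ℝ) ^ (-(1 - 2 * p))) * (M m j : ℝ) ^ (-p) +
          (∑ b ∈ Finset.range (i + 1), (M m b : ℝ) ^ p) * (M m j : ℝ)⁻¹)) := by
          rw [← Finset.mul_sum, Finset.sum_add_distrib, Finset.sum_mul, Finset.sum_mul]
          ring
      _ ≤ A * (M m i : ℝ) ^ (-(1 - p)) * (M m j * (C₂ * (M m j : ℝ) ^ (-p) +
          (C₁ * (M m i : ℝ) ^ p) * (M m j : ℝ)⁻¹)) := by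
          gcongr
          exact h₁ i
      _ = A * (C₂ * ((M m i : ℝ) ^ (-(1 - p)) * (M m j * (M m j : ℝ) ^ (-p))) +
          C₁ * ((M m i : ℝ) ^ (-(1 - p)) * (M m i : ℝ) ^ p) * (M m j * (M m j : ℝ)⁻¹)) := by ring
      _ = _ := by
          rw [mul_inv_cancel₀ (hpos j).ne', ← Real.rpow_add (hpos i),
            ← Real.rpow_one_add' (hpos j).le (by linarith), mul_one]
          ring_nf
  refine ⟨A * (C₂ * (C₃ * (B : ℝ) ^ (1 - p)) + C₁ * C₂), by positivity, fun j N => ?_⟩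
  refine (Finset.sum_le_sum fun i _ => step i j).trans ?_
  rw [← Finset.mul_sum, Finset.sum_add_distrib, ← Finset.mul_sum, ← Finset.mul_sum,
    ← Finset.sum_mul]
  -- Starting one index before `j` costs a factor `B`. For `j = 0` the truncated subtraction gives
  -- `M_0 = 1 ≤ B`.
  have hjB : (M m j : ℝ) ≤ B * M m (j - 1) := by
    rcases j with _ | j
    · have := (hm 0).trans (hB 0)
      have h1 : (1 : ℝ) ≤ B := by exact_mod_cast (by omega)
      simpa [M] using h1
    · exact_mod_cast M_succ_le hB j
  have e3 : (∑ i ∈ Finset.Ico (j - 1) N, (M m i : ℝ) ^ (-(1 - p))) * (M m j : ℝ) ^ (1 - p) ≤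
      C₃ * (B : ℝ) ^ (1 - p) := by
    calc _ ≤ C₃ * (M m (j - 1) : ℝ) ^ (-(1 - p)) * (B * M m (j - 1)) ^ (1 - p) :=
          mul_le_mul (h₃ _ _) (Real.rpow_le_rpow (hpos j).le hjB (by linarith)) (by positivity)
            (by positivity)
      _ = C₃ * (B : ℝ) ^ (1 - p) *
          ((M m (j - 1) : ℝ) ^ (-(1 - p)) * (M m (j - 1) : ℝ) ^ (1 - p)) := by
          rw [Real.mul_rpow (by positivity) (by positivity)]; ring
      _ = _ := by rw [← Real.rpow_add (hpos _), neg_add_cancel, Real.rpow_zero, mul_one]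
  have e4 : ∑ i ∈ Finset.Ico (j - 1) N, (M m i : ℝ) ^ (-(1 - 2 * p)) ≤ C₂ :=
    (h₂ _ _).trans (mul_le_of_le_one_right hC₂
      (Real.rpow_le_one_of_one_le_of_nonpos (hone _) (by linarith)))
  exact mul_le_mul_of_nonneg_left (add_le_add (mul_le_mul_of_nonneg_left e3 hC₂)
    (mul_le_mul_of_nonneg_left e4 hC₁)) hA

/-- The weighted maximal operator of the logarithmic means is bounded from `H_p` to `L_p`. -/
theorem exists_eLpNorm_rieszMaxP_le (hm : ∀ k, 2 ≤ m k) {B : ℕ} (hB : ∀ k, m k ≤ B) {p : ℝ}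
    (hp0 : 0 < p) (hp : p < 1 / 2) : ∃ C : ℝ≥0, ∀ f : ℕ → G m → ℂ, IsMart m f →
      eLpNorm (rieszMaxP p f) (ENNReal.ofReal p) (haar m) ≤ C * hardyNorm m p f := by
  have : ∀ k, NeZero (m k) := fun k => ⟨by have := hm k; omega⟩
  obtain ⟨C₁, hC₁, h₁⟩ := exists_sum_cellWeight_le hm hB hp0 hp
  obtain ⟨C₂, h₂⟩ := exists_tsum_jump_rpow_le hp0
  refine ⟨(C₁.toNNReal * C₂) ^ (1 / p), fun f hf => ?_⟩
  have key : ∫⁻ x, rieszMaxP p f x ^ p ∂haar m ≤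
      ENNReal.ofReal C₁ * (C₂ * ∫⁻ x, maximal f x ^ p ∂haar m) := by
    refine (lintegral_rieszMaxP_rpow_le hm hB hp0 hp hf).trans ?_
    set κ : ℕ → ℕ → ℝ := fun i j => M m j * ∑ b ∈ Finset.range (i + 1),
      ∑ a ∈ Finset.range (b + 1), cellWeight m B p i j b a ^ p * (B / M m (min b j))
    have hκ : ∀ i j, 0 ≤ κ i j := fun i j => mul_nonneg (by positivity)
      (Finset.sum_nonneg fun b _ => Finset.sum_nonneg fun a _ => mul_nonneg
        (Real.rpow_nonneg (cellWeight_nonneg ..) _) (by positivity))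
    have hmaxm : Measurable fun x => (maximal f x) ^ p := by
      refine (Measurable.iSup fun n => ?_).pow_const p
      exact ((hf.stronglyMeasurable n).measurable.mono ((filtration m).le n) le_rfl).enorm
    -- Exchange the sums so that, for fixed `j`, the weights add up over `i ≥ j - 1`.
    calc ∑' i, ∑ j ∈ Finset.range (i + 2),
          ENNReal.ofReal (κ i j) * ∫⁻ x, martJump f j x ^ p ∂haar m
        ≤ ∑' i, ∑' j, (if j - 1 ≤ i then ENNReal.ofReal (κ i j) else 0) *
            ∫⁻ x, martJump f j x ^ p ∂haar m := by
          refine ENNReal.tsum_le_tsum fun i => ?_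
          refine le_trans (Finset.sum_le_sum fun j hj => ?_)
            (ENNReal.sum_le_tsum (Finset.range (i + 2)))
          rw [Finset.mem_range] at hj
          rw [if_pos (by omega)]
      _ = ∑' j, (∑' i, if j - 1 ≤ i then ENNReal.ofReal (κ i j) else 0) *
            ∫⁻ x, martJump f j x ^ p ∂haar m := by
          rw [ENNReal.tsum_comm]
          simp only [ENNReal.tsum_mul_right]
      _ ≤ ∑' j, ENNReal.ofReal C₁ * ∫⁻ x, martJump f j x ^ p ∂haar m := by
          refine ENNReal.tsum_le_tsum fun j => mul_le_mul_left ?_ _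
          refine ENNReal.tsum_le_of_sum_range_le fun N => ?_
          rw [← Finset.sum_filter]
          refine le_trans ?_ (ENNReal.ofReal_le_ofReal (h₁ j N))
          rw [ENNReal.ofReal_sum_of_nonneg fun i _ => hκ i j]
          refine Finset.sum_le_sum_of_subset fun i hi => ?_
          rw [Finset.mem_filter, Finset.mem_range] at hi
          exact Finset.mem_Ico.2 ⟨hi.2, hi.1⟩
      _ = ENNReal.ofReal C₁ * ∫⁻ x, ∑' j, martJump f j x ^ p ∂haar m := by
          rw [ENNReal.tsum_mul_left, lintegral_tsum fun j =>
            ((isLevel_martJump hf j).measurable.pow_const p).aemeasurable]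
      _ ≤ ENNReal.ofReal C₁ * ∫⁻ x, C₂ * maximal f x ^ p ∂haar m := by
          gcongr with x
          exact h₂ _
      _ = _ := by rw [lintegral_const_mul _ hmaxm]
  have hp' : ENNReal.ofReal p ≠ 0 := by simpa using hp0
  rw [hardyNorm, eLpNorm_eq_lintegral_rpow_enorm_toReal hp' ENNReal.ofReal_ne_top,
    eLpNorm_eq_lintegral_rpow_enorm_toReal hp' ENNReal.ofReal_ne_top, ENNReal.toReal_ofReal hp0.le,
    ENNReal.coe_rpow_of_nonneg _ (by positivity), ← ENNReal.mul_rpow_of_nonneg _ _ (by positivity)]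
  refine ENNReal.rpow_le_rpow ?_ (by positivity)
  simp only [enorm_eq_self]
  rw [ENNReal.coe_mul, mul_assoc]
  exact key

/-! ### A martingale whose logarithmic means are large -/

/-- The function `M_N r_N 1_{I_N(0)}`. -/
noncomputable def bump (m : ℕ → ℕ) (N : ℕ) : G m → ℂ :=
  (cyl N 0).indicator fun x => M m N * rademacher m N x

/-- The martingale generated by `bump m N`. -/
noncomputable def bumpMart (m : ℕ → ℕ) (N j : ℕ) : G m → ℂ := if j ≤ N then 0 else bump m N

theorem isLevel_rademacher (N : ℕ) : IsLevel (N + 1) (rademacher m N) := fun x y h => by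
  rw [rademacher, rademacher, h N (Nat.lt_succ_self N)]

theorem isLevel_bump (N : ℕ) : IsLevel (N + 1) (bump m N) := by
  intro x y h
  have e : y ∈ cyl N (0 : G m) ↔ x ∈ cyl N 0 :=
    forall₂_congr fun k hk => by rw [h k (hk.trans (Nat.lt_succ_self N))]
  by_cases hx : x ∈ cyl N 0
  · rw [bump, Set.indicator_of_mem hx, Set.indicator_of_mem (e.2 hx), isLevel_rademacher N x y h]
  · rw [bump, Set.indicator_of_notMem hx, Set.indicator_of_notMem (mt e.1 hx)]

theorem norm_bump_le (N : ℕ) (x : G m) : ‖bump m N x‖ ≤ M m N := by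
  by_cases hx : x ∈ cyl N 0
  · rw [bump, Set.indicator_of_mem hx, norm_mul, norm_rademacher, mul_one, Complex.norm_natCast]
  · rw [bump, Set.indicator_of_notMem hx, norm_zero]
    positivity

theorem integrable_bump (hm : ∀ k, 2 ≤ m k) (N : ℕ) : Integrable (bump m N) (haar m) := by
  have := isProbabilityMeasure_haar hm
  exact Integrable.of_bound (isLevel_bump N).measurable.aestronglyMeasurable (M m N)
    (Eventually.of_forall (norm_bump_le N))

theorem cyl_eq_iUnion (N : ℕ) (x : G m) :
    cyl N x = ⋃ c : ZMod (m N), cyl (N + 1) (Function.update x N c) := by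
  ext y
  rw [Set.mem_iUnion]
  constructor
  · intro h
    refine ⟨y N, fun k hk => ?_⟩
    by_cases hkN : k = N
    · subst hkN; simp
    · rw [Function.update_of_ne hkN]; exact h k (by omega)
  · rintro ⟨c, h⟩ k hk
    rw [h k (by omega), Function.update_of_ne (by omega)]

theorem setIntegral_rademacher_cyl (hm : ∀ k, 2 ≤ m k) (N : ℕ) (x : G m) :
    ∫ y in cyl N x, rademacher m N y ∂haar m = 0 := by
  have hprob := isProbabilityMeasure_haar hm
  have hne : NeZero (m N) := ⟨by have := hm N; omega⟩
  have hint : Integrable (rademacher m N) (haar m) :=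
    Integrable.of_bound (isLevel_rademacher N).measurable.aestronglyMeasurable 1
      (Eventually.of_forall fun y => (norm_rademacher N y).le)
  rw [cyl_eq_iUnion, integral_iUnion_fintype (fun c => measurableSet_cyl _ _)
    (fun c d hcd => Set.disjoint_left.2 fun y hc hd => hcd ?_) fun c => hint.integrableOn]
  · have e : ∀ c : ZMod (m N), ∫ y in cyl (N + 1) (Function.update x N c),
        rademacher m N y ∂haar m = ((M m (N + 1) : ℝ)⁻¹ : ℝ) * ZMod.stdAddChar c := by
      intro c
      rw [setIntegral_congr_fun (g := fun _ => ZMod.stdAddChar c) (measurableSet_cyl _ _)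
        fun y hy => ?_, setIntegral_const, Complex.real_smul, measureReal_def, haar_cyl hm,
        ENNReal.toReal_inv, ENNReal.toReal_natCast]
      simp only [rademacher_eq hm]
      rw [hy N (Nat.lt_succ_self N), Function.update_self]
    simp only [e]
    rw [← Finset.mul_sum, AddChar.sum_eq_zero_of_ne_one, mul_zero]
    intro h
    have : Fact (1 < m N) := ⟨hm N⟩
    have h1 := ZMod.injective_stdAddChar (N := m N) (a₁ := 1) (a₂ := 0)
      (by rw [h]; simp)
    exact one_ne_zero h1
  · have h1 := hc N (Nat.lt_succ_self N)
    have h2 := hd N (Nat.lt_succ_self N)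
    rw [Function.update_self] at h1 h2
    exact h1.symm.trans h2

/-- An `F_j`-set with `j ≤ N` either contains `I_N(0)` or misses it, and `r_N` has mean zero on
`I_N(0)`. -/
theorem setIntegral_bump (hm : ∀ k, 2 ≤ m k) {N j : ℕ} (hj : j ≤ N) {S : Set (G m)}
    (hS : MeasurableSet[filtration m j] S) : ∫ x in S, bump m N x ∂haar m = 0 := by
  rw [bump, setIntegral_indicator (measurableSet_cyl N 0)]
  have hS' := (filtration m).mono hj S hS
  by_cases h0 : (0 : G m) ∈ S
  · rw [Set.inter_eq_right.2 fun x hx => (mem_iff_mem_of_mem_cyl hS' hx).2 h0,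
      integral_const_mul, setIntegral_rademacher_cyl hm, mul_zero]
  · have : S ∩ cyl N 0 = ∅ := Set.eq_empty_of_forall_notMem fun x hx =>
      h0 ((mem_iff_mem_of_mem_cyl hS' hx.2).1 hx.1)
    rw [this, setIntegral_empty]

theorem isMart_bumpMart (hm : ∀ k, 2 ≤ m k) (N : ℕ) : IsMart m (bumpMart m N) := by
  have := isProbabilityMeasure_haar hm
  have hmeas : ∀ i, ¬ i ≤ N → StronglyMeasurable[filtration m i] (bump m N) := fun i hi =>
    ((isLevel_bump N).mono (by omega)).measurable_filtration.stronglyMeasurable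
  refine ⟨fun i => ?_, fun i j hij => ?_⟩
  · by_cases hi : i ≤ N
    · simp only [bumpMart, if_pos hi]
      exact stronglyMeasurable_zero
    · simp only [bumpMart, if_neg hi]
      exact hmeas i hi
  · by_cases hj : j ≤ N
    · simp only [bumpMart, if_pos hj, if_pos (hij.trans hj), condExp_zero]
      exact EventuallyEq.rfl
    by_cases hi : i ≤ N
    · simp only [bumpMart, if_pos hi, if_neg hj]
      refine (ae_eq_condExp_of_forall_setIntegral_eq ((filtration m).le i) (integrable_bump hm N)
        (fun S _ _ => (integrable_zero _ _ _).integrableOn) (fun S hS _ => ?_)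
        stronglyMeasurable_zero.aestronglyMeasurable).symm
      rw [setIntegral_bump hm hi hS]
      simp
    · simp only [bumpMart, if_neg hi, if_neg hj]
      rw [condExp_of_stronglyMeasurable ((filtration m).le i) (hmeas i hi) (integrable_bump hm N)]

theorem bumpMart_succ (N : ℕ) : bumpMart m N (N + 1) = bump m N := by
  simp [bumpMart]

theorem psi_at_zero (n : ℕ) : psi m n 0 = 1 := by
  simp [psi, rademacher]

/-- For `i < M m N` the function `psi m i` equals one on `I_N(0)`, so the coefficient is the mean of
`bump m N`. -/
theorem coeff_bumpMart_of_lt (hm : ∀ k, 2 ≤ m k) {N i : ℕ} (hi : i < M m N) :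
    coeff (bumpMart m N) i = 0 := by
  rw [coeff_eq hm (isMart_bumpMart hm N) (n := N + 1)
    (hi.trans_le (monotone_M hm (Nat.le_succ N))), bumpMart_succ]
  have e : ∀ x, bump m N x * (starRingEnd ℂ) (psi m i x) = bump m N x := by
    intro x
    by_cases hx : x ∈ cyl N 0
    · rw [isLevel_psi hm hi 0 x hx, psi_at_zero, map_one, mul_one]
    · rw [bump, Set.indicator_of_notMem hx, zero_mul]
  simp only [e]
  rw [← setIntegral_univ, setIntegral_bump hm le_rfl MeasurableSet.univ]

theorem coeff_bumpMart_self (hm : ∀ k, 2 ≤ m k) (N : ℕ) : coeff (bumpMart m N) (M m N) = 1 := by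
  have hlt : M m N < M m (N + 1) := by
    have := two_mul_M_le hm N
    have := M_pos hm N
    omega
  have hpsi : ∀ x, psi m (M m N) x = rademacher m N x := fun x => by
    have := psi_mul_M hm (c := 1) (l := N) (by have := hm N; omega) x
    rwa [one_mul, pow_one] at this
  rw [coeff_eq hm (isMart_bumpMart hm N) hlt, bumpMart_succ]
  have e : (fun x => bump m N x * (starRingEnd ℂ) (psi m (M m N) x)) =
      (cyl N 0).indicator fun _ => (M m N : ℂ) := by
    ext x
    by_cases hx : x ∈ cyl N 0
    · rw [bump, Set.indicator_of_mem hx, Set.indicator_of_mem hx, hpsi, mul_assoc,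
        Complex.mul_conj', norm_rademacher]
      simp
    · rw [bump, Set.indicator_of_notMem hx, Set.indicator_of_notMem hx, zero_mul]
  have hM : (M m N : ℂ) ≠ 0 := by exact_mod_cast (M_pos hm N).ne'
  rw [e, integral_indicator_const _ (measurableSet_cyl N 0), measureReal_def, haar_cyl hm,
    ENNReal.toReal_inv, ENNReal.toReal_natCast, Complex.real_smul]
  push_cast
  exact inv_mul_cancel₀ hM

/-- Only the last term `k = M m N + 1` of the mean is nonzero, and there the partial sum is the
unimodular function `psi m (M m N)`. -/
theorem norm_riesz_bumpMart (hm : ∀ k, 2 ≤ m k) (N : ℕ) (x : G m) :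
    ‖riesz (M m N + 1) (bumpMart m N) x‖ = (ell (M m N + 1))⁻¹ * (M m N + 1 : ℝ)⁻¹ := by
  have h0 : ∀ k ≤ M m N, partialSum k (bumpMart m N) x = 0 := fun k hk =>
    Finset.sum_eq_zero fun i hi => by
      rw [coeff_bumpMart_of_lt hm ((Finset.mem_range.1 hi).trans_le hk), zero_mul]
  have h1 : partialSum (M m N + 1) (bumpMart m N) x = psi m (M m N) x := by
    have := h0 _ le_rfl
    rw [partialSum] at this
    rw [partialSum, Finset.sum_range_succ, this, coeff_bumpMart_self hm, zero_add, one_mul]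
  rw [norm_riesz_eq, Finset.sum_Icc_succ_top (by omega), Finset.sum_eq_zero fun k hk => by
    rw [h0 k (Finset.mem_Icc.1 hk).2, zero_div], zero_add, h1, norm_div, norm_psi,
    Complex.norm_natCast, one_div]
  push_cast
  rfl

theorem maximal_bumpMart_le (N : ℕ) (x : G m) :
    maximal (bumpMart m N) x ≤ (cyl N 0).indicator (fun _ => (M m N : ℝ≥0∞)) x := by
  refine iSup_le fun j => ?_
  by_cases hj : j ≤ N
  · simp [bumpMart, hj]
  · rw [bumpMart, if_neg hj]
    by_cases hx : x ∈ cyl N 0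
    · rw [Set.indicator_of_mem hx, ← ofReal_norm, ← ENNReal.ofReal_natCast]
      exact ENNReal.ofReal_le_ofReal (norm_bump_le N x)
    · rw [bump, Set.indicator_of_notMem hx, enorm_zero]
      exact zero_le

theorem hardyNorm_bumpMart_le (hm : ∀ k, 2 ≤ m k) {p : ℝ} (hp : 0 < p) (N : ℕ) :
    hardyNorm m p (bumpMart m N) ≤ ENNReal.ofReal ((M m N : ℝ) ^ (1 - 1 / p)) := by
  have hp' : ENNReal.ofReal p ≠ 0 := by simpa using hp
  have hM : (0 : ℝ) < M m N := by exact_mod_cast M_pos hm N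
  rw [hardyNorm, eLpNorm_eq_lintegral_rpow_enorm_toReal hp' ENNReal.ofReal_ne_top,
    ENNReal.toReal_ofReal hp.le]
  simp only [enorm_eq_self]
  have h1 : ∫⁻ x, maximal (bumpMart m N) x ^ p ∂haar m ≤
      ENNReal.ofReal ((M m N : ℝ) ^ (p - 1)) := by
    calc ∫⁻ x, maximal (bumpMart m N) x ^ p ∂haar m
        ≤ ∫⁻ x, (cyl N 0).indicator (fun _ => (M m N : ℝ≥0∞) ^ p) x ∂haar m := by
          refine lintegral_mono fun x => ?_
          refine (ENNReal.rpow_le_rpow (maximal_bumpMart_le N x) hp.le).trans_eq ?_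
          by_cases hx : x ∈ cyl N 0
          · rw [Set.indicator_of_mem hx, Set.indicator_of_mem hx]
          · rw [Set.indicator_of_notMem hx, Set.indicator_of_notMem hx,
              ENNReal.zero_rpow_of_pos hp]
      _ = (M m N : ℝ≥0∞) ^ p * (M m N : ℝ≥0∞)⁻¹ := by
          rw [lintegral_indicator_const (measurableSet_cyl N 0), haar_cyl hm]
      _ = ENNReal.ofReal ((M m N : ℝ) ^ (p - 1)) := by
          rw [Real.rpow_sub_one hM.ne', ENNReal.ofReal_div_of_pos hM,
            ← ENNReal.ofReal_rpow_of_pos hM, ENNReal.ofReal_natCast, div_eq_mul_inv]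
  refine (ENNReal.rpow_le_rpow h1 (by positivity)).trans_eq ?_
  rw [ENNReal.ofReal_rpow_of_pos (by positivity), ← Real.rpow_mul hM.le]
  congr 2
  field_simp

/-! ### From the test martingales to the growth of `φ` -/

theorem le_weakNorm (hm : ∀ k, 2 ≤ m k) (p : ℝ) {g : G m → ℝ≥0∞} {t : ℝ≥0}
    (h : ∀ x, (t : ℝ≥0∞) < g x) : (t : ℝ≥0∞) ≤ weakNorm m p g := by
  have := isProbabilityMeasure_haar hm
  refine le_trans ?_ (le_iSup _ t)
  rw [Set.eq_univ_of_forall (s := {x | (t : ℝ≥0∞) < g x}) h, measure_univ, ENNReal.one_rpow, mul_one]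

/-- On the test martingale the maximal function is at least `1 / (ell n * n * φ n)` everywhere,
hence so is its weak norm; compare this with the Hardy norm bound `M_N^(1 - 1/p)`. -/
theorem M_rpow_le_of_bounded (hm : ∀ k, 2 ≤ m k) {p : ℝ} (hp : 0 < p) {φ : ℕ+ → ℝ}
    (hφ : ∀ n, 1 ≤ φ n) {C : ℝ≥0} (hC : ∀ f : ℕ → G m → ℂ, MemHardy m p f →
      weakNorm m p (rieszMaxWeight φ f) ≤ C * hardyNorm m p f) (N : ℕ) (n : ℕ+)
    (hn : (n : ℕ) = M m N + 1) :
    (M m N : ℝ) ^ (1 / p - 2) ≤ 4 * C * (1 + Real.log n) * φ n := by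
  have hM : (0 : ℝ) < M m N := by exact_mod_cast M_pos hm N
  have hM1 : (1 : ℝ) ≤ M m N := by exact_mod_cast M_pos hm N
  have hnr : (n : ℝ) = M m N + 1 := by exact_mod_cast hn
  have hell : 0 < ell n := by
    refine lt_of_lt_of_le (Real.log_pos ?_) (log_add_one_le_ell n)
    linarith
  have hφn := hφ n
  have hH := hardyNorm_bumpMart_le hm hp N
  have hw := (hC _ ⟨isMart_bumpMart hm N, hH.trans_lt ENNReal.ofReal_lt_top⟩).trans
    (mul_le_mul_right hH _)
  set c : ℝ := (ell n)⁻¹ * (n : ℝ)⁻¹ / φ n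
  have hc : 0 < c := by positivity
  -- Halving `c` gives the strict inequality required by the level sets in the weak norm.
  have hlow : ∀ x, ((c / 2).toNNReal : ℝ≥0∞) < rieszMaxWeight φ (bumpMart m N) x := by
    intro x
    refine lt_of_lt_of_le ?_ (le_iSup _ n)
    have e : ‖riesz (n : ℕ) (bumpMart m N) x‖ = (ell n)⁻¹ * (n : ℝ)⁻¹ := by
      rw [hnr, hn, norm_riesz_bumpMart hm]
    rw [e]
    exact (ENNReal.ofReal_lt_ofReal_iff hc).2 (half_lt_self hc)
  have h1 := (le_weakNorm hm p hlow).trans hw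
  have h2 : c / 2 ≤ C * (M m N : ℝ) ^ (1 - 1 / p) := by
    rw [← ENNReal.ofReal_coe_nnreal (p := C), ← ENNReal.ofReal_mul C.coe_nonneg] at h1
    exact (ENNReal.ofReal_le_ofReal_iff (by positivity)).1 h1
  have h3 : 1 ≤ 2 * C * (M m N : ℝ) ^ (1 - 1 / p) * (ell n * n * φ n) := by
    have : c * (ell n * n * φ n) = 1 := by simp only [c]; field_simp
    calc (1 : ℝ) = 2 * (c / 2) * (ell n * n * φ n) := by rw [mul_div_cancel₀ _ two_ne_zero, this]
      _ ≤ 2 * (C * (M m N : ℝ) ^ (1 - 1 / p)) * (ell n * n * φ n) := by gcongr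
      _ = _ := by ring
  have hlog : 0 ≤ Real.log n := Real.log_nonneg (by linarith)
  calc (M m N : ℝ) ^ (1 / p - 2)
      ≤ (M m N : ℝ) ^ (1 / p - 2) *
        (2 * C * (M m N : ℝ) ^ (1 - 1 / p) * (ell n * n * φ n)) :=
        le_mul_of_one_le_right (by positivity) h3
    _ ≤ (M m N : ℝ) ^ (1 / p - 2) * (2 * C * (M m N : ℝ) ^ (1 - 1 / p) *
        ((1 + Real.log n) * (2 * M m N) * φ n)) := by
        gcongr
        · exact ell_le_one_add_log n
        · linarith
    _ = 4 * C * (1 + Real.log n) * φ n *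
        ((M m N : ℝ) ^ (1 / p - 2) * (M m N : ℝ) ^ (1 - 1 / p) * M m N) := by ring
    _ = _ := by
        rw [← Real.rpow_add hM, ← Real.rpow_add_one hM.ne',
          show 1 / p - 2 + (1 - 1 / p) + 1 = 0 by ring, Real.rpow_zero, mul_one]

theorem exists_M_lt_le (hm : ∀ k, 2 ≤ m k) {n : ℕ} (hn : 2 ≤ n) :
    ∃ N, M m N < n ∧ n ≤ M m (N + 1) := by
  classical
  have h : ∃ N, n ≤ M m (N + 1) := ⟨n, ((lt_M hm (n + 1)).le.trans' (Nat.le_succ n))⟩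
  refine ⟨Nat.find h, ?_, Nat.find_spec h⟩
  rcases e : Nat.find h with _ | k
  · exact hn
  · exact not_le.1 (Nat.find_min h (by omega))

/-- If `φ` grows too slowly, then `sup_n |R_n f| / φ(n)` is not bounded from `H_p` to weak `L_p`. -/
theorem limsup_lt_top_of_bounded (hm : ∀ k, 2 ≤ m k) {B : ℕ} (hB : ∀ k, m k ≤ B) {p : ℝ}
    (hp0 : 0 < p) (hp : p < 1 / 2) {φ : ℕ+ → ℝ} (hφ : ∀ n, 1 ≤ φ n) (hmono : Monotone φ) {C : ℝ≥0}
    (hC : ∀ f : ℕ → G m → ℂ, MemHardy m p f →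
      weakNorm m p (rieszMaxWeight φ f) ≤ C * hardyNorm m p f) :
    limsup (fun n : ℕ+ => ((((n : ℝ) + 1) ^ (1 / p - 2) /
        (Real.log ((n : ℝ) + 1) * φ n) : ℝ) : EReal)) atTop < ⊤ := by
  have hα : 0 ≤ 1 / p - 2 := by
    rw [sub_nonneg, le_div_iff₀ hp0]; linarith
  -- The base `2 * B` comes from `n + 1 ≤ 2 * B * M_N`, and `12 = 4 * 3` from `1 + log k ≤ 3 * log
  -- (n + 1)`.
  refine lt_of_le_of_lt (limsup_le_of_le (a := (((2 * B : ℝ) ^ (1 / p - 2) * (12 * C) : ℝ) : EReal))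
    (by isBoundedDefault) ?_) (EReal.coe_lt_top _)
  filter_upwards [eventually_ge_atTop (2 : ℕ+)] with n hn
  have hn2 : 2 ≤ (n : ℕ) := hn
  have hn2' : (2 : ℝ) ≤ n := by exact_mod_cast hn2
  obtain ⟨N, hN1, hN2⟩ := exists_M_lt_le hm hn2
  have hlog : 1 / 2 ≤ Real.log ((n : ℝ) + 1) := by
    have h1 : Real.log 2 ≤ Real.log ((n : ℝ) + 1) := Real.log_le_log two_pos (by linarith)
    have := Real.log_two_gt_d9
    linarith
  have hφn := hφ n
  rw [EReal.coe_le_coe_iff, div_le_iff₀ (by positivity)]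
  -- The largest test index not exceeding `n`; the monotonicity of `φ` carries the bound from `k` to
  -- `n`.
  set k : ℕ+ := ⟨M m N + 1, Nat.succ_pos _⟩
  have hk := M_rpow_le_of_bounded hm hp0 hφ hC N k rfl
  have hkn : k ≤ n := hN1
  have hknr : (k : ℝ) ≤ n := by exact_mod_cast hkn
  have hkpos : (0 : ℝ) < k := by exact_mod_cast k.2
  have hlogk : Real.log k ≤ Real.log ((n : ℝ) + 1) := Real.log_le_log hkpos (by linarith)
  have hlogk0 : 0 ≤ Real.log k := Real.log_nonneg (by exact_mod_cast k.2)
  have hφk := hφ k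
  have hbase : (n : ℝ) + 1 ≤ 2 * B * M m N := by
    have h1 := M_succ_le hB N
    have h2 : (n : ℝ) ≤ B * M m N := by exact_mod_cast hN2.trans h1
    linarith
  calc ((n : ℝ) + 1) ^ (1 / p - 2) ≤ (2 * B * M m N) ^ (1 / p - 2) :=
        Real.rpow_le_rpow (by positivity) hbase hα
    _ = (2 * B : ℝ) ^ (1 / p - 2) * (M m N : ℝ) ^ (1 / p - 2) :=
        Real.mul_rpow (by positivity) (by positivity)
    _ ≤ (2 * B : ℝ) ^ (1 / p - 2) * (4 * C * (3 * Real.log ((n : ℝ) + 1)) * φ n) := by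
        gcongr
        refine hk.trans ?_
        gcongr
        · linarith
        · exact hmono hkn
    _ = _ := by ring

end Vilenkin

theorem theorem3 (m : ℕ → ℕ) (hm : ∀ k, 2 ≤ m k) (hbdd : BddAbove (Set.range m))
    (p : ℝ) (hp0 : 0 < p) (hp : p < 1 / 2) :
    (∃ C : ℝ≥0, ∀ f : ℕ → Vilenkin.G m → ℂ, Vilenkin.MemHardy m p f →
      eLpNorm (Vilenkin.rieszMaxP p f) (ENNReal.ofReal p) (Vilenkin.haar m)
        ≤ C * Vilenkin.hardyNorm m p f) ∧
    (∀ φ : ℕ+ → ℝ, (∀ n, 1 ≤ φ n) → Monotone φ →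
      limsup (fun n : ℕ+ => ((((n : ℝ) + 1) ^ (1 / p - 2) /
        (Real.log ((n : ℝ) + 1) * φ n) : ℝ) : EReal)) atTop = ⊤ →
      ¬ ∃ C : ℝ≥0, ∀ f : ℕ → Vilenkin.G m → ℂ, Vilenkin.MemHardy m p f →
        Vilenkin.weakNorm m p (Vilenkin.rieszMaxWeight φ f) ≤ C * Vilenkin.hardyNorm m p f) := by
  obtain ⟨B, hB⟩ := hbdd
  have hB' : ∀ k, m k ≤ B := fun k => hB ⟨k, rfl⟩
  refine ⟨?_, ?_⟩
  · obtain ⟨C, hC⟩ := Vilenkin.exists_eLpNorm_rieszMaxP_le hm hB' hp0 hp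
    exact ⟨C, fun f hf => hC f hf.1⟩
  · rintro φ hφ hmono hlim ⟨C, hC⟩
    exact (Vilenkin.limsup_lt_top_of_bounded hm hB' hp0 hp hφ hmono hC).ne hlim
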